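/- All trees are finite. For a rooted tree $T$ write $T=[T_1,\dots,T_k]$ if $T_1,\dots,T_k$ are the components of $T$ minus its root, rooted at the neighbours of the root of $T$; let $\bullet$ be the one-vertex tree and, for an integer $d\ge 1$, let $[d]$ be the star with $d$ vertices rooted at its centre (so $[1]=\bullet$). \textbf{Exchange-extremality.} Let $\rho$ be a real-valued invariant of rooted trees. If $H$ is a tree with two distinct leaves $v,w$, let $[L_1,\dots,L_k]\,vHw\,[R_1,\dots,R_\ell]$ be the tree obtained from $H$ by merging the root of $[L_1,\dots,L_k]$ with $v$ and the root of $[R_1,\dots,R_\ell]$ with $w$. A tree $T$ is \emph{$\rho$-exchange-extremal} if for every decomposition $T=[L_1,\dots,L_k]\,vHw\,[R_1,\dots,R_\ell]$ we have either $k\ge \ell$ and $\rho(L_i)\ge\rho(R_j)$ for all $i,j$, or $k\le \ell$ and $\rho(L_i)\le\rho(R_j)$ for all $i,j$. \textbf{$\mathcal M$-trees.} Let $d_1\ge d_2\ge\dots\ge d_t\ge 2$, $t\ge1$. The tree $\mathcal M(d_1,\dots,d_t)$, with some of its vertices labelled $v_1,v_2,\dots$, is defined recursively. If $t\le d_t+1$,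 it is $[[d_1],\dots,[d_{t-1}],[1],\dots,[1]]$ with root of degree $d_t$; the root is $v_1$, and the roots of $[d_{t-1}],[d_{t-2}],\dots,[d_1]$ are $v_2,\dots,v_t$, in this order. If $t\ge d_t+2$, take the labelled tree $\mathcal M(d_{d_t},\dots,d_{t-1})$, with labels $v_1,\dots,v_m$, and let $s$ be the smallest index such that $v_s$ is adjacent to a leaf; merge such a leaf with the root of $[[d_1],\dots,[d_{d_t-1}]]$ and label the roots of $[d_{d_t-1}],\dots,[d_1]$, in this order, $v_{m+1},\dots,v_{m+d_t-1}$. The \emph{reduced degree sequence} of a tree with at least three vertices is the non-increasing sequence of its vertex degrees that are at least $2$. For the degree sequence $D$ of such a tree, $\mathcal M(D)$ denotes $\mathcal M(d_1,\dots,d_t)$, where $(d_1,\dots,d_t)$ is the reduced degree sequence. \textbf{Theorem.} Let $\rho$ be a real-valued invariant of rooted trees such that \begin{enumerate} \item $\rho([T_1,\dots,T_k])=f_\rho(\rho(T_1),\dots,\rho(T_k))$ for all $k\ge1$ and all rooted trees $T_1,\dots,T_k$, where $f_\rho$ is a symmetric function (of any positive number of variables); \item $f_\rho$ is strictly decreasing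 in each single variable and strictly decreasing under addition of further variables, the variables ranging over the values of $\rho$; \item $\rho(\bullet)>\rho(B)$ for every rooted tree $B$ with more than one vertex. \end{enumerate} If a tree $T$ with at least three vertices and degree sequence $D$ is $\rho$-exchange-extremal, then $T$ is isomorphic to the $\mathcal M$-tree $\mathcal M(D)$. -/

import Mathlib

/-- Finite rooted trees: `node [T₁, …, T_k]` is the rooted tree `[T₁, …, T_k]`, whose branches
(the components left when the root is removed, rooted at the neighbours of the root) are
`T₁, …, T_k`. The order of the branches is immaterial: all trees are compared up to graph
isomorphism, and rooted invariants are required to satisfy a symmetric recurrence. -/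
inductive RTree : Type
  | node (branches : List RTree) : RTree

namespace RTree

/-- The branches of a rooted tree. -/
def branches : RTree → List RTree
  | node ts => ts

/-- The tree `•` with a single vertex. -/
def leaf : RTree := node []

/-- The star `[d]` with `d` vertices, i.e. a root with `d - 1` leaves attached to it. -/
def star (d : ℕ) : RTree := node (List.replicate (d - 1) leaf)

/-- Vertices are addressed by lists of natural numbers: `[]` is the root, and `i :: a` is the
vertex with address `a` in the `i`-th branch. `sub? a t` is the subtree consisting of the vertex
at address `a` and its descendants (`none` if there is no such vertex). -/
def sub? : List ℕ → RTree → Option RTree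
  | [], t => some t
  | i :: a, t => (t.branches[i]?).bind (sub? a)

/-- Replace the subtree at address `a` by `R`. If the vertex at `a` is a leaf, this merges the root
of `R` with that leaf. -/
def graft : List ℕ → RTree → RTree → RTree
  | [], _, R => R
  | i :: a, t, R => node (t.branches.modify i (fun u => graft a u R))

/-- The vertex set of a rooted tree. -/
def Vertex (t : RTree) : Type := {a : List ℕ // (sub? a t).isSome}

/-- The underlying (unrooted) graph of a rooted tree: edges join each vertex to its children. -/
def graph (t : RTree) : SimpleGraph t.Vertex where
  Adj x y := ∃ i : ℕ, y.1 = x.1 ++ [i] ∨ x.1 = y.1 ++ [i]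
  symm := ⟨fun _ _ ⟨i, h⟩ => ⟨i, h.symm⟩⟩
  loopless := ⟨fun x ⟨i, h⟩ => by rcases h with h | h <;> simpa using congrArg List.length h⟩

/-- The address of the first leaf among the children of the vertex with address `a`, if any. -/
def leafChild? (t : RTree) (a : List ℕ) : Option (List ℕ) :=
  (sub? a t).bind fun u => (u.branches.findIdx? (fun c => c.branches.isEmpty)).map (a ++ [·])

end RTree

open RTree in
/-- The labelled tree `M(d₁, …, d_t)` for `d₁ ≥ ⋯ ≥ d_t`, together with the list of addresses of
the labelled vertices `v₁, v₂, …`. The degrees are passed in the reverse, i.e. non-decreasing,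
order `[d_t, d_{t-1}, …, d₁]`; below `d` is `d_t` and `es` is `[d_{t-1}, …, d₁]`.
* If `t ≤ d_t + 1`, the tree is `[[d_{t-1}], …, [d₁], [1], …, [1]]` with root of degree `d_t`;
  `v₁` is the root and `v₂, …, v_t` are the roots of the stars `[d_{t-1}], …, [d₁]`.
* If `t ≥ d_t + 2`, start from `M(d_{d_t}, …, d_{t-1})`, take the first labelled vertex `v_s` that
  is adjacent to a leaf, merge that leaf with the root of `[[d₁], …, [d_{d_t - 1}]]`, and append
  the roots of `[d_{d_t - 1}], …, [d₁]`, in this order, to the labelled vertices.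

The value in the cases `[]` and `none` is irrelevant: if the list is non-empty with all entries at
least `2`, there always is a labelled vertex adjacent to a leaf. -/
def mTreeLabelled : List ℕ → RTree × List (List ℕ)
  | [] => (leaf, [])
  | d :: es =>
    if es.length ≤ d then
      (node (es.map star ++ List.replicate (d - es.length) leaf),
        [] :: (List.range es.length).map (fun j => [j]))
    else
      let M := mTreeLabelled (es.take (es.length - (d - 1)))
      let outer := es.drop (es.length - (d - 1))
      match M.2.findSome? M.1.leafChild? with
      | none => M
      | some a =>
        (graft a M.1 (node (outer.map star)),
          M.2 ++ (List.range outer.length).map (fun j => a ++ [j]))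
termination_by l => l.length
decreasing_by simp

/-- The `M`-tree with reduced degree sequence `d₁ ≥ ⋯ ≥ d_t`, given as the list
`[d_t, …, d₁]`, as an unlabelled tree. -/
def mTree (ds : List ℕ) : RTree := (mTreeLabelled ds).1

/-- The reduced degree sequence of a finite graph: its vertex degrees that are at least `2`,
in non-decreasing order. -/
def reducedDegrees {V : Type*} [Fintype V] (T : SimpleGraph V) [DecidableRel T.Adj] : List ℕ :=
  ((Finset.univ.val.map fun v : V => T.degree v).filter (2 ≤ ·)).sort (· ≤ ·)

/-- `T` is `ρ`-exchange-extremal: whenever `T` is decomposed as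
`[L₁, …, L_k] v H w [R₁, …, R_ℓ]`, with `v ≠ w` leaves of a tree `H`, then `k ≥ ℓ` and
`min ρ(L_i) ≥ max ρ(R_j)`, or `k ≤ ℓ` and `max ρ(L_i) ≤ min ρ(R_j)`.

Rooting `H` at its leaf `v` turns it into `[H']`, where `w` is a childless vertex of `H'`,
at some address `a`. Merging the root of `[L₁, …, L_k]` with `v` and the root of `[R₁, …, R_ℓ]`
with `w` gives the tree `[L₁, …, L_k, H'']`, where `H''` is `H'` with the leaf `w` replaced by
`[R₁, …, R_ℓ]`. -/
def ExchangeExtremal {V : Type*} (ρ : RTree → ℝ) (T : SimpleGraph V) : Prop :=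
  ∀ (L R : List RTree) (H' : RTree) (a : List ℕ), H'.sub? a = some RTree.leaf →
    Nonempty (T ≃g (RTree.node (L ++ [H'.graft a (RTree.node R)])).graph) →
    (R.length ≤ L.length ∧ ∀ l ∈ L, ∀ r ∈ R, ρ r ≤ ρ l) ∨
    (L.length ≤ R.length ∧ ∀ l ∈ L, ∀ r ∈ R, ρ l ≤ ρ r)

/-- `ρ([T₁, …, T_k]) = f(ρ(T₁), …, ρ(T_k))` for a symmetric function `f` of any positive number of
variables (a function of the multiset of its arguments). -/
def HasRecurrenceRule (ρ : RTree → ℝ) (f : Multiset ℝ → ℝ) : Prop :=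
  ∀ ts : List RTree, ts ≠ [] → ρ (RTree.node ts) = f (ts.map ρ : List ℝ)

/-- `f` is strictly decreasing in each single variable and under addition of further variables,
where the variables range over the set `S`. -/
def StrictlyDecreasingRule (f : Multiset ℝ → ℝ) (S : Set ℝ) : Prop :=
  (∀ s : Multiset ℝ, (∀ z ∈ s, z ∈ S) → ∀ x ∈ S, ∀ y ∈ S, x < y → f (y ::ₘ s) < f (x ::ₘ s)) ∧
  (∀ s : Multiset ℝ, s ≠ 0 → (∀ z ∈ s, z ∈ S) → ∀ x ∈ S, f (x ::ₘ s) < f s)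

/-! A directed edge from `p` to `a` has a value: that of `ρ` at the branch at `a` leading away from
`p`. Exchange-extremality compares the degrees and outgoing values at any two vertices, and since
`ρ` is decreasing, more and larger sub-branches make a smaller branch. This alternation forces the
tree to be dismantled from the outside in.

Let `S` be the set of vertices of degree at least 2. At the start all edges leaving `S` end in
leaves and have the maximal value; they are the high tips, and there are no low tips. Low tips
always lie below all edges inside `S`, high tips above. If every degree in `S` is at least the
number of low tips plus 2, some vertex of maximal degree has largest high tips at all its neighbours
but one; its branch then has the smallest inner value and is contracted to a new low tip. Otherwise
some vertex of minimal degree has smallest low tips at all its neighbours but one and is contracted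
to a new high tip (`ContractionState.exists_contraction`). Ties do no harm, because disjoint
branches of equal value are represented by the same rooted trees (`IsBranch.transfer`).

Read backwards, the contractions are an assembly of the tree from its sorted degrees and its leaves
(`ContractionState.assembles`, `IsTree.exists_assembles`). The rule `Assembles` does not prescribe
which kind of step comes next, but it is confluent (`Assembles.sameUnrooted`): the unrooted result
depends only on the initial lists. The recursion for the `M`-tree is one particular schedule: `d_t -
1` low steps, then one high step (`mTree_assembles`). The number of leaves is determined by the
degrees (`Assembles.length_add`), so both assemblies start from the same data and give the same
unrooted tree. -/

/-! ### Distances in trees -/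

namespace SimpleGraph

variable {V : Type*} {T : SimpleGraph V}

/-- In a tree, at most one neighbour of a vertex is closer to a given vertex. -/
lemma IsTree.eq_of_adj_of_dist (hT : T.IsTree) {v a b w : V} (ha : T.Adj v a) (hb : T.Adj v b)
    (hda : T.dist a w + 1 = T.dist v w) (hdb : T.dist b w + 1 = T.dist v w) : a = b := by
  obtain ⟨p, hp⟩ := hT.connected.exists_walk_length_eq_dist a w
  obtain ⟨q, hq⟩ := hT.connected.exists_walk_length_eq_dist b w
  have h1 : (Walk.cons ha p).IsPath := Walk.isPath_of_length_eq_dist _ (by simp [hp, hda])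
  have h2 : (Walk.cons hb q).IsPath := Walk.isPath_of_length_eq_dist _ (by simp [hq, hdb])
  have h := (hT.isAcyclic.subsingleton_path v w).elim ⟨_, h1⟩ ⟨_, h2⟩
  have h' := congrArg (fun r : T.Path v w => r.1.snd) h
  simpa using h'

/-- A neighbour of `v` in the direction of another vertex `w`. -/
lemma IsTree.exists_adj_dist (hT : T.IsTree) {v w : V} (h : v ≠ w) :
    ∃ a, T.Adj v a ∧ T.dist a w + 1 = T.dist v w := by
  obtain ⟨p, hp⟩ := hT.connected.exists_walk_length_eq_dist v w
  cases p with
  | nil => exact absurd rfl h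
  | @cons _ a _ hva q =>
    refine ⟨a, hva, ?_⟩
    have h1 := T.dist_le q
    have h2 := hT.connected.dist_triangle (u := v) (v := a) (w := w)
    rw [dist_eq_one_iff_adj.2 hva] at h2
    simp at hp
    omega

variable [Fintype V]

open Classical in
/-- The neighbours of `v` that are farther away from `w` than `v` is. -/
noncomputable def away (T : SimpleGraph V) (v w : V) : Finset V :=
  Finset.univ.filter fun a => T.Adj v a ∧ T.dist a w = T.dist v w + 1

lemma mem_away {v w a : V} : a ∈ T.away v w ↔ T.Adj v a ∧ T.dist a w = T.dist v w + 1 := by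
  simp [away]

lemma mem_away_self {v a : V} : a ∈ T.away v v ↔ T.Adj v a := by
  rw [mem_away]
  refine ⟨fun h => h.1, fun h => ⟨h, ?_⟩⟩
  rw [dist_self, dist_comm, dist_eq_one_iff_adj.2 h]

lemma IsTree.away_or (hT : T.IsTree) {v a : V} (h : T.Adj v a) (w : V) :
    a ∈ T.away v w ∨ T.dist a w + 1 = T.dist v w := by
  rw [mem_away]
  have := hT.dist_eq_dist_add_one_of_adj w h
  rw [dist_comm (u := w), dist_comm (u := w)] at this
  simp only [h, true_and]
  omega

/-- The step from `v` towards `w`, as the complement of `away v w` in the neighbourhood of `v`. -/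
lemma IsTree.exists_step (hT : T.IsTree) {v w : V} (h : v ≠ w) :
    ∃ p, T.Adj v p ∧ T.dist p w + 1 = T.dist v w ∧ p ∉ T.away v w ∧
      ∀ a, a ∈ T.away v w ↔ T.Adj v a ∧ a ≠ p := by
  obtain ⟨p, hp, hd⟩ := hT.exists_adj_dist h
  have hn : p ∉ T.away v w := by rw [mem_away]; omega
  refine ⟨p, hp, hd, hn, fun a => ⟨fun ha => ⟨(mem_away.1 ha).1, ?_⟩, fun ha => ?_⟩⟩
  · rintro rfl; exact hn ha
  · rcases hT.away_or ha.1 w with h' | h'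
    · exact h'
    · exact absurd (hT.eq_of_adj_of_dist ha.1 hp h' hd) ha.2

lemma mem_away_of_adj (hT : T.IsTree) {v p a : V} (hp : T.Adj v p) :
    a ∈ T.away v p ↔ T.Adj v a ∧ a ≠ p := by
  obtain ⟨q, hq, hd, hn, h⟩ := hT.exists_step hp.ne
  have : q = p := by
    have h1 := dist_eq_one_iff_adj.2 hp
    have : T.dist q p = 0 := by omega
    exact hT.connected.dist_eq_zero_iff.1 this
  subst this
  exact h a

/-- Moving the reference vertex farther away behind `v` does not change what is away from it. -/
lemma IsTree.away_eq_of_between (hT : T.IsTree) {w v x : V} (hx : x ≠ v)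
    (h : T.dist x w = T.dist x v + T.dist v w) : T.away x w = T.away x v := by
  have hxw : x ≠ w := by
    rintro rfl
    have := hT.connected.pos_dist_of_ne hx
    rw [dist_self] at h; omega
  obtain ⟨p, hp, hd, -, h1⟩ := hT.exists_step hx
  obtain ⟨q, hq, hd', -, h2⟩ := hT.exists_step hxw
  have : p = q := by
    refine hT.eq_of_adj_of_dist (w := w) hp hq ?_ hd'
    have h3 := hT.connected.dist_triangle (u := p) (v := v) (w := w)
    have h4 := hT.connected.dist_triangle (u := x) (v := p) (w := w)
    rw [dist_eq_one_iff_adj.2 hp] at h4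
    omega
  subst this
  ext a; rw [h1, h2]

lemma IsTree.away_away (hT : T.IsTree) {v w c : V} (hc : c ∈ T.away v w) :
    T.away c w = T.away c v := by
  have h := mem_away.1 hc
  have h1 : T.dist c v = 1 := by rw [dist_comm]; exact dist_eq_one_iff_adj.2 h.1
  exact hT.away_eq_of_between h.1.ne' (by omega)

/-- If the step from `v` to `c` leads away from `w` and towards `x`, then `v` lies between
`w` and `x`. -/
lemma IsTree.dist_add_of_away (hT : T.IsTree) {v w c x : V} (hc : c ∈ T.away v w)
    (hx : T.dist v x = T.dist c x + 1) : T.dist w x = T.dist w v + T.dist v x := by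
  induction hn : T.dist v w generalizing v c with
  | zero =>
    obtain rfl := hT.connected.dist_eq_zero_iff.1 hn
    simp
  | succ n ih =>
    have hvw : v ≠ w := by rintro rfl; simp at hn
    obtain ⟨p, hp, hd, hpn, -⟩ := hT.exists_step hvw
    have hpx : T.dist p x = T.dist v x + 1 := by
      rcases hT.away_or hp x with h | h
      · exact (mem_away.1 h).2
      · exact absurd (hT.eq_of_adj_of_dist hp (mem_away.1 hc).1 h hx.symm)
          (by rintro rfl; exact hpn hc)
    -- The step from `p` back to `v` leads away from `w` and towards `x`, so the induction moves one
    -- vertex closer to `w`.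
    have := ih (v := p) (c := v) (mem_away.2 ⟨hp.symm, hd.symm⟩) hpx (by omega)
    rw [dist_comm (u := w), dist_comm (u := w) (v := v)] at *
    rw [dist_comm (u := w) (v := p)] at this
    omega

/-- For branches pointing away from each other, each root can serve as the reference vertex for the
other. This lets the comparison of two branches descend to their sub-branches. -/
lemma IsTree.away_pair (hT : T.IsTree) {v w x y : V} (hvw : v ≠ w) (hx : x ∈ T.away v w)
    (hy : y ∈ T.away w v) : x ≠ y ∧ T.away x y = T.away x v ∧ T.away y x = T.away y w := by
  have hx' := mem_away.1 hx
  have hy' := mem_away.1 hy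
  have h1 : T.dist x v = 1 := by rw [dist_comm]; exact dist_eq_one_iff_adj.2 hx'.1
  have h2 : T.dist y w = 1 := by rw [dist_comm]; exact dist_eq_one_iff_adj.2 hy'.1
  have h3 : T.away w x = T.away w v :=
    hT.away_eq_of_between hvw.symm (by rw [dist_comm, hx'.2, h1.symm, dist_comm (u := x) (v := v),
      dist_comm (u := v) (v := w)])
  have h4 : T.dist y x = T.dist w x + 1 := (mem_away.1 (h3 ▸ hy)).2
  have h5 := dist_comm (G := T) (u := w) (v := x)
  have h6 := dist_comm (G := T) (u := y) (v := x)
  have h7 := dist_comm (G := T) (u := y) (v := v)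
  have h8 := dist_comm (G := T) (u := w) (v := v)
  refine ⟨?_, hT.away_eq_of_between hx'.1.ne' (by omega),
    hT.away_eq_of_between hy'.1.ne' (by omega)⟩
  rintro rfl
  simp at h4

lemma IsTree.away_siblings (hT : T.IsTree) {v x y : V} (hx : T.Adj v x) (hy : T.Adj v y)
    (hxy : x ≠ y) : T.away x y = T.away x v := by
  have h := mem_away.1 ((mem_away_of_adj hT hy).2 ⟨hx, hxy⟩)
  have h1 : T.dist x v = 1 := by rw [dist_comm]; exact dist_eq_one_iff_adj.2 hx
  exact hT.away_eq_of_between hx.ne' (by omega)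

lemma IsTree.card_away_add_one (hT : T.IsTree) {v w : V} (h : v ≠ w) :
    (T.away v w).card + 1 = (T.away v v).card := by
  classical
  obtain ⟨p, hp, hd, hn, h⟩ := hT.exists_step h
  have : T.away v v = insert p (T.away v w) := by
    ext a
    rw [Finset.mem_insert, h, mem_away_self]
    constructor
    · intro ha; by_cases hap : a = p <;> simp [*]
    · rintro (rfl | ha); exacts [hp, ha.1]
  rw [this, Finset.card_insert_of_notMem hn]

end SimpleGraph

/-! ### Branches of a tree as rooted trees -/

namespace RTree

theorem induction {P : RTree → Prop} (h : ∀ ts, (∀ t ∈ ts, P t) → P (node ts)) (t : RTree) : P t :=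
  RTree.rec (motive_1 := P) (motive_2 := fun ts => ∀ t ∈ ts, P t) h (by simp)
    (fun t ts ht hts u hu => by
      rcases List.mem_cons.1 hu with rfl | hu
      exacts [ht, hts u hu]) t

lemma sub?_cons_node (i : ℕ) (a : List ℕ) (ts : List RTree) :
    sub? (i :: a) (node ts) = (ts[i]?).bind (sub? a) := rfl

lemma isSome_sub?_cons {i : ℕ} {a : List ℕ} {ts : List RTree} :
    (sub? (i :: a) (node ts)).isSome ↔ ∃ h : i < ts.length, (sub? a ts[i]).isSome := by
  rw [sub?_cons_node]
  by_cases h : i < ts.length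
  · simp [h]
  · simp [h]

end RTree

open RTree

namespace SimpleGraph

variable {V : Type*} [Fintype V] {T : SimpleGraph V}

/-- The rooted tree `t` represents the branch of `T` at `v` that leads away from `w`
(the whole of `T`, rooted at `v`, if `v = w`). -/
inductive IsBranch (T : SimpleGraph V) : V → V → RTree → Prop
  | mk {w v : V} (l : List V) (ts : List RTree) (hl : l.Nodup) (hmem : ∀ x, x ∈ l ↔ x ∈ T.away v w)
      (hlen : l.length = ts.length)
      (hts : ∀ i (h : i < l.length) (h' : i < ts.length), IsBranch T v l[i] ts[i]) :
      IsBranch T w v (node ts)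

lemma isBranch_node {w v : V} {ts : List RTree} : IsBranch T w v (node ts) ↔
    ∃ l : List V, l.Nodup ∧ (∀ x, x ∈ l ↔ x ∈ T.away v w) ∧ List.Forall₂ (IsBranch T v) l ts := by
  constructor
  · rintro ⟨l, _, h1, h2, h3, h4⟩
    exact ⟨l, h1, h2, List.forall₂_iff_get.2 ⟨h3, h4⟩⟩
  · rintro ⟨l, h1, h2, h3⟩
    exact ⟨l, _, h1, h2, h3.length_eq, (List.forall₂_iff_get.1 h3).2⟩

lemma IsBranch.congr {w w' v : V} {t : RTree} (h : IsBranch T w v t)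
    (hw : T.away v w = T.away v w') : IsBranch T w' v t := by
  cases h with
  | mk l ts h1 h2 h3 h4 => exact ⟨l, ts, h1, fun x => by rw [h2, hw], h3, h4⟩

lemma length_eq_card_away {w v : V} {l : List V} (hl : l.Nodup)
    (hmem : ∀ x, x ∈ l ↔ x ∈ T.away v w) : l.length = (T.away v w).card := by
  classical
  rw [← List.toFinset_card_of_nodup hl]
  congr 1
  ext x; simp [hmem]

lemma IsTree.exists_isBranch (hT : T.IsTree) (w v : V) : ∃ t, IsBranch T w v t := by
  -- Distances from `w` grow along a branch and are bounded by `M`, so `M + 1 - T.dist v w` is a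
  -- decreasing measure.
  obtain ⟨M, hM⟩ : ∃ M, ∀ x, T.dist x w ≤ M :=
    ⟨Finset.univ.sup fun x => T.dist x w, fun x => Finset.le_sup (f := fun x => T.dist x w)
      (Finset.mem_univ x)⟩
  induction hn : M + 1 - T.dist v w using Nat.strong_induction_on generalizing v with
  | _ n ih =>
    have key : ∀ c ∈ (T.away v w).toList, ∃ t, IsBranch T v c t := by
      intro c hc
      rw [Finset.mem_toList] at hc
      have h := (mem_away.1 hc).2
      have := hM c
      obtain ⟨t, ht⟩ := ih _ (by omega) c rfl
      exact ⟨t, ht.congr (hT.away_away hc)⟩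
    obtain ⟨ts, hts⟩ : ∃ ts, List.Forall₂ (IsBranch T v) (T.away v w).toList ts := by
      revert key
      generalize (T.away v w).toList = l
      intro key
      induction l with
      | nil => exact ⟨[], .nil⟩
      | cons c l ihl =>
        obtain ⟨ts, hts⟩ := ihl fun c hc => key c (List.mem_cons_of_mem _ hc)
        obtain ⟨t, ht⟩ := key c List.mem_cons_self
        exact ⟨t :: ts, .cons ht hts⟩
    exact ⟨node ts, isBranch_node.2 ⟨_, Finset.nodup_toList _, by simp, hts⟩⟩

/-- The vertices of a branch are addressed by the vertices of a rooted tree representing it. -/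
lemma IsBranch.exists_coordinates (hT : T.IsTree) (t : RTree) :
    ∀ w v, IsBranch T w v t → ∃ e : List ℕ → V, e [] = v ∧
      (∀ a, (sub? a t).isSome → T.dist v (e a) = a.length ∧
        T.dist w (e a) = T.dist w v + a.length) ∧
      (∀ a i, (sub? (a ++ [i]) t).isSome → T.Adj (e a) (e (a ++ [i]))) ∧
      (∀ a, (sub? a t).isSome → ∀ y ∈ T.away (e a) w,
        ∃ i, (sub? (a ++ [i]) t).isSome ∧ e (a ++ [i]) = y) ∧
      (∀ a b, (sub? a t).isSome → (sub? b t).isSome → e a = e b → a = b) := by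
  induction t using RTree.induction with
  | h ts ih =>
  intro w v hb
  obtain ⟨l, hl, hmem, hts⟩ := isBranch_node.1 hb
  have hlen := hts.length_eq
  have key : ∀ i (h : i < l.length), IsBranch T v l[i] (ts[i]'(hlen ▸ h)) := fun i h =>
    (List.forall₂_iff_get.1 hts).2 i h (hlen ▸ h)
  have key2 := fun i (h : i < l.length) =>
    ih (ts[i]'(hlen ▸ h)) (List.getElem_mem _) v l[i] (key i h)
  choose e he0 hed hea hes hei using key2
  have hc : ∀ i (h : i < l.length), l[i] ∈ T.away v w := fun i h =>
    (hmem _).1 (List.getElem_mem _)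
  have hadj : ∀ i (h : i < l.length), T.Adj v l[i] := fun i h => (mem_away.1 (hc i h)).1
  have hdv : ∀ i (h : i < l.length) a, (sub? a (ts[i]'(hlen ▸ h))).isSome →
      T.dist v (e i h a) = a.length + 1 := fun i h a ha => by
    rw [(hed i h a ha).2, dist_eq_one_iff_adj.2 (hadj i h), add_comm]
  have hdw : ∀ i (h : i < l.length) a, (sub? a (ts[i]'(hlen ▸ h))).isSome →
      T.dist w (e i h a) = T.dist w v + T.dist v (e i h a) := fun i h a ha =>
    hT.dist_add_of_away (hc i h) (by rw [hdv i h a ha, (hed i h a ha).1])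
  -- The default `v` at invalid addresses is harmless, as all the required properties only concern
  -- valid ones.
  let E : List ℕ → V := fun a => match a with
    | [] => v
    | i :: a => if h : i < l.length then e i h a else v
  have hE : ∀ i (h : i < l.length) a, E (i :: a) = e i h a := fun i h a => by simp [E, h]
  refine ⟨E, rfl, ?_, ?_, ?_, ?_⟩
  · intro a ha
    cases a with
    | nil => simp [E]
    | cons i a =>
      obtain ⟨h, ha⟩ := isSome_sub?_cons.1 ha
      rw [← hlen] at h
      rw [hE i h, hdw i h a ha, hdv i h a ha]
      simp
  · intro a j ha
    cases a with
    | nil =>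
      obtain ⟨h, ha⟩ := isSome_sub?_cons.1 ha
      rw [← hlen] at h
      rw [List.nil_append, hE j h, he0]
      exact hadj j h
    | cons i a =>
      obtain ⟨h, ha⟩ := isSome_sub?_cons.1 ha
      rw [← hlen] at h
      rw [List.cons_append, hE i h, hE i h]
      exact hea i h a j ha
  · intro a ha y hy
    cases a with
    | nil =>
      obtain ⟨j, h, rfl⟩ := List.getElem_of_mem ((hmem y).2 hy)
      refine ⟨j, isSome_sub?_cons.2 ⟨hlen ▸ h, rfl⟩, ?_⟩
      rw [List.nil_append, hE j h, he0]
    | cons i a =>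
      obtain ⟨h, ha⟩ := isSome_sub?_cons.1 ha
      rw [← hlen] at h
      rw [hE i h] at hy
      have hne : e i h a ≠ v := by
        intro h0
        have := hdv i h a ha
        rw [h0, dist_self] at this
        omega
      rw [hT.away_eq_of_between hne (by
        rw [dist_comm, hdw i h a ha, dist_comm (u := w), dist_comm (v := v), add_comm])] at hy
      obtain ⟨j, hj, rfl⟩ := hes i h a ha y hy
      refine ⟨j, isSome_sub?_cons.2 ⟨hlen ▸ h, hj⟩, ?_⟩
      rw [List.cons_append, hE i h]
  · intro a b ha hb hab
    have hz : ∀ i (h : i < l.length) a, (sub? a (ts[i]'(hlen ▸ h))).isSome → v ≠ e i h a := by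
      intro i h a ha h0
      have := hdv i h a ha
      rw [← h0, dist_self] at this
      omega
    cases a with
    | nil =>
      cases b with
      | nil => rfl
      | cons j b =>
        obtain ⟨h, hb⟩ := isSome_sub?_cons.1 hb
        rw [← hlen] at h
        rw [hE j h] at hab
        exact absurd hab (hz j h b hb)
    | cons i a =>
      obtain ⟨h, ha⟩ := isSome_sub?_cons.1 ha
      rw [← hlen] at h
      rw [hE i h] at hab
      cases b with
      | nil => exact absurd hab.symm (hz i h a ha)
      | cons j b =>
        obtain ⟨h', hb⟩ := isSome_sub?_cons.1 hb
        rw [← hlen] at h'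
        rw [hE j h'] at hab
        have hij : l[i] = l[j] := by
          refine hT.eq_of_adj_of_dist (w := e i h a) (hadj i h) (hadj j h') ?_ ?_
          · rw [hdv i h a ha, (hed i h a ha).1]
          · rw [hab, hdv j h' b hb, (hed j h' b hb).1]
        have := (hl.getElem_inj_iff).1 hij
        subst this
        rw [hei i h a b ha hb hab]

/-- A tree is isomorphic to the graph of any rooted tree that represents it. -/
theorem IsBranch.nonempty_iso (hT : T.IsTree) {v : V} {t : RTree} (h : IsBranch T v v t) :
    Nonempty (T ≃g t.graph) := by
  obtain ⟨e, he0, hed, hea, hes, hei⟩ := IsBranch.exists_coordinates hT t v v h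
  have hsurj : ∀ n x, T.dist x v = n → ∃ a, (sub? a t).isSome ∧ e a = x := by
    intro n
    induction n with
    | zero =>
      intro x hx
      obtain rfl := hT.connected.dist_eq_zero_iff.1 hx
      exact ⟨[], rfl, he0⟩
    | succ n ih =>
      intro x hx
      have hxv : x ≠ v := by rintro rfl; simp at hx
      obtain ⟨p, hp, hd⟩ := hT.exists_adj_dist hxv
      obtain ⟨a, ha, rfl⟩ := ih p (by omega)
      obtain ⟨i, hi, rfl⟩ := hes a ha x (mem_away.2 ⟨hp.symm, hd.symm⟩)
      exact ⟨_, hi, rfl⟩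
  let f : t.Vertex → V := fun a => e a.1
  have hf : Function.Bijective f := by
    refine ⟨fun a b hab => Subtype.ext (hei _ _ a.2 b.2 hab), fun x => ?_⟩
    obtain ⟨a, ha, rfl⟩ := hsurj _ x rfl
    exact ⟨⟨a, ha⟩, rfl⟩
  have hfwd : ∀ a b : t.Vertex, T.Adj (f a) (f b) → T.dist (f b) v = T.dist (f a) v + 1 →
      ∃ i, b.1 = a.1 ++ [i] := by
    intro a b hab hd
    obtain ⟨i, hi, hi'⟩ := hes a.1 a.2 (f b) (mem_away.2 ⟨hab, hd⟩)
    exact ⟨i, (hei _ _ hi b.2 hi').symm⟩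
  refine ⟨RelIso.symm ⟨Equiv.ofBijective f hf, ?_⟩⟩
  intro a b
  change T.Adj (f a) (f b) ↔ ∃ i : ℕ, b.1 = a.1 ++ [i] ∨ a.1 = b.1 ++ [i]
  constructor
  · intro hab
    rcases hT.away_or hab v with h | h
    · obtain ⟨i, hi⟩ := hfwd a b hab (mem_away.1 h).2
      exact ⟨i, Or.inl hi⟩
    · obtain ⟨i, hi⟩ := hfwd b a hab.symm h.symm
      exact ⟨i, Or.inr hi⟩
  · rintro ⟨i, hi | hi⟩
    · have := hea a.1 i (hi ▸ b.2)
      rw [← hi] at this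
      exact this
    · have := hea b.1 i (hi ▸ a.2)
      rw [← hi] at this
      exact this.symm

/-- Moving the root along an edge. -/
lemma IsBranch.reroot (hT : T.IsTree) {v : V} {ls hs : List RTree}
    (h : IsBranch T v v (node (node hs :: ls))) :
    ∃ w, IsBranch T w w (node (node ls :: hs)) := by
  obtain ⟨l, hl, hmem, hts⟩ := isBranch_node.1 h
  cases hts with
  | @cons x _ l₁ _ hx h₁ =>
  obtain ⟨l', hl', hmem', hts'⟩ := isBranch_node.1 hx
  obtain ⟨hxl, hl₁⟩ := List.nodup_cons.1 hl
  have hvx : T.Adj v x := mem_away_self.1 ((hmem x).1 (by simp))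
  refine ⟨x, isBranch_node.2 ⟨v :: l', ?_, ?_, .cons (isBranch_node.2 ⟨l₁, hl₁, ?_, h₁⟩) hts'⟩⟩
  · refine List.nodup_cons.2 ⟨fun ha => ?_, hl'⟩
    exact ((mem_away_of_adj hT hvx.symm).1 ((hmem' _).1 ha)).2 rfl
  · intro y
    rw [List.mem_cons, hmem', mem_away_of_adj hT hvx.symm, mem_away_self]
    by_cases hy : y = v
    · subst hy; simp [hvx.symm]
    · simp [hy]
  · intro y
    have hy := hmem y
    rw [List.mem_cons, mem_away_self] at hy
    rw [mem_away_of_adj hT hvx, ← hy]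
    constructor
    · intro h
      refine ⟨Or.inr h, ?_⟩
      rintro rfl
      exact hxl h
    · rintro ⟨h | h, h'⟩
      exacts [absurd h h', h]

/-- A branch contains a representation of each of its sub-branches. -/
lemma IsBranch.exists_sub? (hT : T.IsTree) {v p w : V} {t : RTree} (h : IsBranch T v p t)
    (hd : T.dist v w = T.dist v p + T.dist p w) : ∃ a u, sub? a t = some u ∧ IsBranch T v w u := by
  induction t using RTree.induction generalizing v p with
  | h ts ih =>
  by_cases hpw : p = w
  · subst hpw
    exact ⟨[], _, rfl, h⟩
  obtain ⟨l, hl, hmem, hts⟩ := isBranch_node.1 h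
  obtain ⟨c, hc, hcd⟩ := hT.exists_adj_dist hpw
  have hpc := dist_eq_one_iff_adj.2 hc
  have hca : c ∈ T.away p v := by
    rcases hT.away_or hc v with h' | h'
    · exact h'
    -- If `c` were closer to `v` than `p` is, a route through `c` would be shorter than the distance
    -- from `v` to `w`.
    · have h1 := hT.connected.dist_triangle (u := v) (v := c) (w := w)
      rw [dist_comm (u := v) (v := c)] at h1
      rw [dist_comm (u := v) (v := p)] at hd
      omega
  obtain ⟨i, hi, rfl⟩ := List.getElem_of_mem ((hmem c).2 hca)
  have hi' : i < ts.length := hts.length_eq ▸ hi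
  obtain ⟨a, u, ha, hu⟩ := ih ts[i] (List.getElem_mem _)
    ((List.forall₂_iff_get.1 hts).2 i hi hi') (by simp only [List.get_eq_getElem]; omega)
  refine ⟨i :: a, u, ?_, hu.congr (hT.away_eq_of_between (Ne.symm hpw) ?_).symm⟩
  · rw [sub?_cons_node, List.getElem?_eq_getElem hi']
    exact ha
  · rw [dist_comm (u := w) (v := v), hd, dist_comm (u := v), dist_comm (u := p) (v := w), add_comm]

end SimpleGraph

/-! ### Grafting -/

namespace RTree

lemma graft_cons_node (i : ℕ) (a : List ℕ) (ts : List RTree) (R : RTree) :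
    graft (i :: a) (node ts) R = node (ts.modify i fun u => graft a u R) := rfl

lemma sub?_graft_self (a : List ℕ) : ∀ {t : RTree} (R : RTree), (sub? a t).isSome →
    sub? a (graft a t R) = some R := by
  induction a with
  | nil => intro t R _; rfl
  | cons i a ih =>
    rintro ⟨ts⟩ R h
    obtain ⟨h1, h2⟩ := isSome_sub?_cons.1 h
    rw [graft_cons_node, sub?_cons_node, List.getElem?_modify_eq, List.getElem?_eq_getElem h1]
    exact ih R h2

lemma graft_graft_self (a : List ℕ) : ∀ (t R R' : RTree),
    graft a (graft a t R) R' = graft a t R' := by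
  induction a with
  | nil => intro t R R'; rfl
  | cons i a ih =>
    rintro ⟨ts⟩ R R'
    rw [graft_cons_node, graft_cons_node, graft_cons_node, List.modify_modify_eq]
    congr 2
    funext u
    exact ih u R R'

lemma graft_of_sub? (a : List ℕ) : ∀ {t u : RTree}, sub? a t = some u → graft a t u = t := by
  induction a with
  | nil => intro t u h; exact (Option.some.inj h).symm
  | cons i a ih =>
    rintro ⟨ts⟩ u h
    obtain ⟨h1, h2⟩ := isSome_sub?_cons.1 (Option.isSome_of_eq_some h)
    rw [sub?_cons_node, List.getElem?_eq_getElem h1] at h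
    simp only [Option.bind_some] at h
    rw [graft_cons_node]
    congr 1
    refine List.ext_getElem (by simp) fun j hj hj' => ?_
    rw [List.getElem_modify]
    split_ifs with hij
    · subst hij; exact ih h
    · rfl

end RTree

/-! ### Consequences of the recurrence rule -/

section Rule

variable {f : Multiset ℝ → ℝ} {S : Set ℝ}

/-- The elements are exchanged one at a time, in the presence of a fixed remainder `u`; any pairing
of `s` with `s'` works because every element of `s` dominates every element of `s'`. -/
lemma StrictlyDecreasingRule.add_le (hf : StrictlyDecreasingRule f S) :
    ∀ (s' s u : Multiset ℝ), (∀ z ∈ s, z ∈ S) → (∀ z ∈ s', z ∈ S) → (∀ z ∈ u, z ∈ S) →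
      s.card = s'.card → (∀ x ∈ s, ∀ y ∈ s', y ≤ x) →
      f (s + u) ≤ f (s' + u) ∧ (f (s + u) = f (s' + u) → ∀ x ∈ s, ∀ y ∈ s', x = y) := by
  intro s'
  induction s' using Multiset.induction_on with
  | empty =>
    intro s u _ _ _ hc _
    obtain rfl := Multiset.card_eq_zero.1 (hc.trans Multiset.card_zero)
    simp
  | cons y s₁' ih =>
    intro s u hs hs' hu hc hle
    obtain ⟨x, hx⟩ := Multiset.card_pos_iff_exists_mem.1
      (show 0 < s.card by rw [hc, Multiset.card_cons]; omega)
    obtain ⟨s₁, rfl⟩ := Multiset.exists_cons_of_mem hx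
    simp only [Multiset.card_cons, add_left_inj] at hc
    have hyS : y ∈ S := hs' y (Multiset.mem_cons_self _ _)
    have hxS : x ∈ S := hs x hx
    have hs₁ : ∀ z ∈ s₁, z ∈ S := fun z hz => hs z (Multiset.mem_cons_of_mem hz)
    have hs₁' : ∀ z ∈ s₁', z ∈ S := fun z hz => hs' z (Multiset.mem_cons_of_mem hz)
    obtain ⟨h1, h2⟩ := ih s₁ (y ::ₘ u) hs₁ hs₁'
      (by intro z hz; rcases Multiset.mem_cons.1 hz with rfl | hz; exacts [hyS, hu z hz]) hc
      (fun a ha b hb => hle a (Multiset.mem_cons_of_mem ha) b (Multiset.mem_cons_of_mem hb))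
    have hyx : y ≤ x := hle x hx y (Multiset.mem_cons_self _ _)
    have hsu : ∀ z ∈ s₁ + u, z ∈ S := by
      intro z hz
      rcases Multiset.mem_add.1 hz with hz | hz
      exacts [hs₁ z hz, hu z hz]
    have e1 : x ::ₘ s₁ + u = x ::ₘ (s₁ + u) := Multiset.cons_add _ _ _
    have e2 : s₁ + y ::ₘ u = y ::ₘ (s₁ + u) := Multiset.add_cons _ _ _
    have e3 : y ::ₘ s₁' + u = s₁' + y ::ₘ u := by
      rw [Multiset.cons_add, Multiset.add_cons]
    rw [e1, e3]
    rw [e2] at h1 h2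
    rcases hyx.lt_or_eq with hlt | rfl
    · have := hf.1 (s₁ + u) hsu y hyS x hxS hlt
      exact ⟨(this.trans_le h1).le, fun h => absurd h (this.trans_le h1).ne⟩
    · refine ⟨h1, fun h => ?_⟩
      have h3 := h2 h
      intro a ha b hb
      rcases Multiset.mem_cons.1 ha with rfl | ha' <;> rcases Multiset.mem_cons.1 hb with rfl | hb'
      · rfl
      -- The head is squeezed between equal elements: some `c` in `s₁` equals `b`, while `b ≤ a ≤
      -- c`.
      · obtain ⟨c, hc'⟩ := Multiset.card_pos_iff_exists_mem.1
          (show 0 < s₁.card by rw [hc]; exact Multiset.card_pos_iff_exists_mem.2 ⟨b, hb'⟩)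
        have := hle c (Multiset.mem_cons_of_mem hc') a (Multiset.mem_cons_self _ _)
        have h4 := h3 c hc' b hb'
        have h5 := hle a ha b hb
        linarith
      · obtain ⟨c, hc'⟩ := Multiset.card_pos_iff_exists_mem.1
          (show 0 < s₁'.card by rw [← hc]; exact Multiset.card_pos_iff_exists_mem.2 ⟨a, ha'⟩)
        have := hle b (Multiset.mem_cons_self _ _) c (Multiset.mem_cons_of_mem hc')
        have h4 := h3 a ha' c hc'
        have h5 := hle a ha b hb
        linarith
      · exact h3 a ha' b hb'

lemma StrictlyDecreasingRule.lt_of_add (hf : StrictlyDecreasingRule f S) {s : Multiset ℝ}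
    (hs : ∀ z ∈ s, z ∈ S) (h0 : s ≠ 0) : ∀ u : Multiset ℝ, (∀ z ∈ u, z ∈ S) → u ≠ 0 →
      f (s + u) < f s := by
  intro u
  induction u using Multiset.induction_on with
  | empty => simp
  | cons x u ih =>
    intro hu _
    have hu' : ∀ z ∈ u, z ∈ S := fun z hz => hu z (Multiset.mem_cons_of_mem hz)
    have h1 : f (x ::ₘ (s + u)) < f (s + u) := by
      refine hf.2 _ (by simp [h0]) ?_ x (hu x (Multiset.mem_cons_self _ _))
      intro z hz
      rcases Multiset.mem_add.1 hz with hz | hz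
      exacts [hs z hz, hu' z hz]
    rw [Multiset.add_cons]
    by_cases hu0 : u = 0
    · subst hu0; simpa using h1
    · exact h1.trans (ih hu' hu0)

/-- More and larger arguments give a smaller value, strictly unless all arguments agree. -/
lemma StrictlyDecreasingRule.le_of_forall_le (hf : StrictlyDecreasingRule f S) {s s' : Multiset ℝ}
    (hs : ∀ z ∈ s, z ∈ S) (hs' : ∀ z ∈ s', z ∈ S) (h0 : s' ≠ 0) (hc : s'.card ≤ s.card)
    (hle : ∀ x ∈ s, ∀ y ∈ s', y ≤ x) :
    f s ≤ f s' ∧ (f s = f s' → s.card = s'.card ∧ ∀ x ∈ s, ∀ y ∈ s', x = y) := by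
  -- Any part of `s` of the right size can be compared with `s'`; the remaining elements only
  -- decrease the value further.
  obtain ⟨s₀, hs₀, hcard⟩ : ∃ s₀ ≤ s, s₀.card = s'.card := by
    induction s using Quotient.inductionOn with
    | h l => exact ⟨(l.take s'.card : List ℝ), (List.take_sublist _ _).subperm, by simpa using hc⟩
  obtain ⟨u, rfl⟩ := Multiset.le_iff_exists_add.1 hs₀
  have h1 := hf.add_le s' s₀ 0 (fun z hz => hs z (Multiset.mem_add.2 (Or.inl hz))) hs' (by simp)
    hcard (fun x hx => hle x (Multiset.mem_add.2 (Or.inl hx)))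
  simp only [add_zero] at h1
  have hs₀0 : s₀ ≠ 0 := by
    rintro rfl
    exact h0 (Multiset.card_eq_zero.1 (by rw [← hcard, Multiset.card_zero]))
  by_cases hu : u = 0
  · subst hu
    rw [add_zero]
    exact ⟨h1.1, fun h => ⟨hcard, h1.2 h⟩⟩
  · have := hf.lt_of_add (fun z hz => hs z (Multiset.mem_add.2 (Or.inl hz))) hs₀0 u
      (fun z hz => hs z (Multiset.mem_add.2 (Or.inr hz))) hu
    exact ⟨(this.trans_le h1.1).le, fun h => absurd h (this.trans_le h1.1).ne⟩

end Rule

/-- The hypotheses on the invariant `ρ`. -/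
structure IsAlternatingInvariant (ρ : RTree → ℝ) (f : Multiset ℝ → ℝ) : Prop where
  recurrence : HasRecurrenceRule ρ f
  decreasing : StrictlyDecreasingRule f (Set.range ρ)
  lt_leaf : ∀ B : RTree, B ≠ leaf → ρ B < ρ leaf

/-- The recurrence says nothing about the one-vertex tree, so the case of no branches rests on the
maximality of its value. -/
lemma IsAlternatingInvariant.le_of_forall_le {ρ : RTree → ℝ} {f : Multiset ℝ → ℝ}
    (hρ : IsAlternatingInvariant ρ f) {ts ts' : List RTree} (hlen : ts'.length ≤ ts.length)
    (hle : ∀ t ∈ ts, ∀ t' ∈ ts', ρ t' ≤ ρ t) :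
    ρ (node ts) ≤ ρ (node ts') ∧ (ρ (node ts) = ρ (node ts') →
      ts.length = ts'.length ∧ ∀ t ∈ ts, ∀ t' ∈ ts', ρ t = ρ t') := by
  by_cases h' : ts' = []
  · subst h'
    by_cases h : ts = []
    · subst h; simp
    · have := hρ.lt_leaf (node ts) (by simpa [leaf] using h)
      exact ⟨this.le, fun h => absurd h this.ne⟩
  · have h : ts ≠ [] := by
      rintro rfl
      exact h' (List.length_eq_zero_iff.1 (Nat.le_zero.1 hlen))
    rw [hρ.recurrence ts h, hρ.recurrence ts' h']
    have key := hρ.decreasing.le_of_forall_le (s := (ts.map ρ : List ℝ)) (s' := (ts'.map ρ : List ℝ))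
      (by simp) (by simp) (by simpa using h') (by simpa using hlen) (by simpa using hle)
    simpa using key

/-! ### Values of branches and the exchange property. -/

namespace SimpleGraph

variable {V : Type*} [Fintype V] {T : SimpleGraph V} {ρ : RTree → ℝ} {f : Multiset ℝ → ℝ}

/-- Representations of the same branch differ only in the order of sub-branches, to which a
symmetric recurrence is blind. This makes the choice in `branchValue` immaterial. -/
lemma IsBranch.value_unique (hρ : IsAlternatingInvariant ρ f) (t : RTree) :
    ∀ {w v : V} {t' : RTree}, IsBranch T w v t → IsBranch T w v t' → ρ t = ρ t' := by
  induction t using RTree.induction with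
  | h ts ih =>
  rintro w v ⟨ts'⟩ h h'
  obtain ⟨l, hl, hmem, hts⟩ := isBranch_node.1 h
  obtain ⟨l', hl', hmem', hts'⟩ := isBranch_node.1 h'
  have hperm : l.Perm l' := (List.perm_ext_iff_of_nodup hl hl').2 fun x => by rw [hmem, hmem']
  have hlen := hts.length_eq
  have hlen' := hts'.length_eq
  by_cases h0 : ts = []
  · subst h0
    have : l = [] := List.length_eq_zero_iff.1 hlen
    subst this
    have := hperm.nil_eq
    subst this
    have : ts' = [] := List.length_eq_zero_iff.1 hlen'.symm
    rw [this]
  · have h0' : ts' ≠ [] := by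
      rintro rfl
      have := hperm.length_eq
      exact h0 (List.length_eq_zero_iff.1 (by simp at hlen'; subst hlen'; simp at this; simp_all))
    rw [hρ.recurrence ts h0, hρ.recurrence ts' h0']
    have key : ∀ c ∈ l, ∃ r, ∀ u, IsBranch T v c u → ρ u = r := by
      intro c hc
      obtain ⟨i, hi, rfl⟩ := List.getElem_of_mem hc
      have hi' : i < ts.length := hlen ▸ hi
      exact ⟨ρ ts[i], fun u hu => (ih ts[i] (List.getElem_mem _)
        ((List.forall₂_iff_get.1 hts).2 i hi hi') hu).symm⟩
    have key : ∃ g : V → ℝ, ∀ c ∈ l, ∀ u, IsBranch T v c u → ρ u = g c := by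
      classical
      choose g hg using key
      exact ⟨fun c => if h : c ∈ l then g c h else 0, fun c hc u hu => by
        simp only [dif_pos hc]; exact hg c hc u hu⟩
    obtain ⟨g, hg⟩ := key
    have aux : ∀ (k : List V) (us : List RTree), (∀ c ∈ k, c ∈ l) →
        List.Forall₂ (IsBranch T v) k us → us.map ρ = k.map g := by
      intro k us hk hku
      induction hku with
      | nil => rfl
      | cons h _ ih' =>
        rw [List.map_cons, List.map_cons, ih' fun c hc => hk c (List.mem_cons_of_mem _ hc),
          hg _ (hk _ List.mem_cons_self) _ h]
    rw [aux l ts (fun _ h => h) hts, aux l' ts' (fun c hc => hperm.mem_iff.2 hc) hts']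
    congr 1
    exact Multiset.coe_eq_coe.2 (hperm.map g)

open Classical in
/-- The value of `ρ` at the branch of `T` at `v` that leads away from `w`. -/
noncomputable def branchValue (ρ : RTree → ℝ) (T : SimpleGraph V) (w v : V) : ℝ :=
  if h : ∃ t, IsBranch T w v t then ρ h.choose else 0

lemma IsBranch.value_eq (hρ : IsAlternatingInvariant ρ f) {w v : V} {t : RTree}
    (h : IsBranch T w v t) : ρ t = branchValue ρ T w v := by
  have h' : ∃ t, IsBranch T w v t := ⟨t, h⟩
  rw [branchValue, dif_pos h']
  exact h.value_unique hρ t h'.choose_spec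

lemma forall_mem_of_forall₂ {α β : Type*} {P : α → β → Prop} {l : List α} {m : List β}
    (h : List.Forall₂ P l m) : ∀ b ∈ m, ∃ a ∈ l, P a b := by
  intro b hb
  obtain ⟨i, hi, rfl⟩ := List.getElem_of_mem hb
  have hi' : i < l.length := h.length_eq ▸ hi
  exact ⟨l[i], List.getElem_mem _, (List.forall₂_iff_get.1 h).2 i hi' hi⟩

lemma forall_mem_of_forall₂' {α β : Type*} {P : α → β → Prop} {l : List α} {m : List β}
    (h : List.Forall₂ P l m) : ∀ a ∈ l, ∃ b ∈ m, P a b := by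
  intro b hb
  obtain ⟨i, hi, rfl⟩ := List.getElem_of_mem hb
  have hi' : i < m.length := h.length_eq ▸ hi
  exact ⟨m[i], List.getElem_mem _, (List.forall₂_iff_get.1 h).2 i hi hi'⟩

/-- A branch with more and larger sub-branches has a smaller value. -/
lemma IsTree.branchValue_le (hT : T.IsTree) (hρ : IsAlternatingInvariant ρ f) {p x q y : V}
    (hcard : (T.away y q).card ≤ (T.away x p).card)
    (hle : ∀ a ∈ T.away x p, ∀ b ∈ T.away y q, branchValue ρ T y b ≤ branchValue ρ T x a) :
    branchValue ρ T p x ≤ branchValue ρ T q y ∧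
      (branchValue ρ T p x = branchValue ρ T q y → (T.away x p).card = (T.away y q).card ∧
        ∀ a ∈ T.away x p, ∀ b ∈ T.away y q, branchValue ρ T x a = branchValue ρ T y b) := by
  obtain ⟨⟨ts⟩, ht⟩ := hT.exists_isBranch p x
  obtain ⟨⟨ts'⟩, ht'⟩ := hT.exists_isBranch q y
  rw [← ht.value_eq hρ, ← ht'.value_eq hρ]
  obtain ⟨l, hl, hmem, hts⟩ := isBranch_node.1 ht
  obtain ⟨l', hl', hmem', hts'⟩ := isBranch_node.1 ht'
  have e1 := length_eq_card_away hl hmem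
  have e2 := length_eq_card_away hl' hmem'
  rw [hts.length_eq] at e1
  rw [hts'.length_eq] at e2
  obtain ⟨h1, h2⟩ := hρ.le_of_forall_le (ts := ts) (ts' := ts') (by omega) (by
    intro t ht t' ht'
    obtain ⟨a, ha, hat⟩ := forall_mem_of_forall₂ hts t ht
    obtain ⟨b, hb, hbt⟩ := forall_mem_of_forall₂ hts' t' ht'
    rw [hat.value_eq hρ, hbt.value_eq hρ]
    exact hle a ((hmem a).1 ha) b ((hmem' b).1 hb))
  refine ⟨h1, fun h => ?_⟩
  obtain ⟨h3, h4⟩ := h2 h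
  refine ⟨by omega, fun a ha b hb => ?_⟩
  obtain ⟨t, ht, hat⟩ := forall_mem_of_forall₂' hts a ((hmem a).2 ha)
  obtain ⟨t', ht', hbt⟩ := forall_mem_of_forall₂' hts' b ((hmem' b).2 hb)
  rw [← hat.value_eq hρ, ← hbt.value_eq hρ]
  exact h4 t ht t' ht'

/-- The exchange property in terms of the values of branches. -/
lemma IsTree.exchange (hT : T.IsTree) (hρ : IsAlternatingInvariant ρ f)
    (hext : ExchangeExtremal ρ T) {v w : V} (hvw : v ≠ w) :
    ((T.away w v).card ≤ (T.away v w).card ∧ ∀ a ∈ T.away v w, ∀ b ∈ T.away w v,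
        branchValue ρ T w b ≤ branchValue ρ T v a) ∨
      ((T.away v w).card ≤ (T.away w v).card ∧ ∀ a ∈ T.away v w, ∀ b ∈ T.away w v,
        branchValue ρ T v a ≤ branchValue ρ T w b) := by
  obtain ⟨p, hp, hd, hpn, haway⟩ := hT.exists_step hvw
  obtain ⟨H, hH⟩ := hT.exists_isBranch v p
  obtain ⟨a, ⟨R⟩, haR, hR⟩ := hH.exists_sub? hT (w := w)
    (by rw [dist_eq_one_iff_adj.2 hp]; omega)
  obtain ⟨⟨L⟩, hL⟩ := hT.exists_isBranch w v
  obtain ⟨l, hl, hmem, hts⟩ := isBranch_node.1 hL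
  obtain ⟨l', hl', hmem', hts'⟩ := isBranch_node.1 hR
  have hwhole : IsBranch T v v (node (L ++ [H])) := by
    refine isBranch_node.2 ⟨l ++ [p], ?_, ?_, List.rel_append hts (.cons hH .nil)⟩
    · rw [List.nodup_append]
      refine ⟨hl, by simp, ?_⟩
      rintro x hx y hy rfl
      rw [List.mem_singleton] at hy
      subst hy
      exact hpn ((hmem _).1 hx)
    · intro x
      rw [List.mem_append, hmem, List.mem_singleton, mem_away_self, haway]
      by_cases hx : x = p
      · subst hx; simp [hp]
      · simp [hx]
  have hsome : (sub? a H).isSome := Option.isSome_of_eq_some haR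
  -- Cutting the branch at `w` off `H` leaves a leaf at address `a`; grafting `R` back there
  -- recovers the whole tree, so this is a legitimate decomposition.
  have key := hext L R (graft a H leaf) a (sub?_graft_self a leaf hsome) (by
    rw [graft_graft_self, graft_of_sub? a haR]
    exact hwhole.nonempty_iso hT)
  have e1 := length_eq_card_away hl hmem
  have e2 := length_eq_card_away hl' hmem'
  rw [hts.length_eq] at e1
  rw [hts'.length_eq] at e2
  rw [← e1, ← e2]
  refine key.imp (fun h => ⟨h.1, fun x hx y hy => ?_⟩) (fun h => ⟨h.1, fun x hx y hy => ?_⟩)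
  all_goals
    obtain ⟨t, ht, hxt⟩ := forall_mem_of_forall₂' hts x ((hmem x).2 hx)
    obtain ⟨t', ht', hyt⟩ := forall_mem_of_forall₂' hts' y ((hmem' y).2 hy)
    rw [← hxt.value_eq hρ, ← hyt.value_eq hρ]
    exact h.2 t ht t' ht'

/-- In an exchange-extremal tree, disjoint branches with the same value are isomorphic. -/
lemma IsBranch.transfer (hT : T.IsTree) (hρ : IsAlternatingInvariant ρ f)
    (hext : ExchangeExtremal ρ T) (t : RTree) : ∀ {x y : V}, x ≠ y → IsBranch T y x t →
      branchValue ρ T y x = branchValue ρ T x y → IsBranch T x y t := by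
  induction t using RTree.induction with
  | h ts ih =>
  intro x y hxy ht heq
  obtain ⟨l, hl, hmem, hts⟩ := isBranch_node.1 ht
  have e1 := length_eq_card_away hl hmem
  have key : (T.away x y).card = (T.away y x).card ∧
      ∀ a ∈ T.away x y, ∀ b ∈ T.away y x, branchValue ρ T x a = branchValue ρ T y b := by
    -- In either alternative of the exchange property, equal total values are the equality case of
    -- monotonicity. All sub-branches on one side then have the same value as all those on the
    -- other, so they may be paired arbitrarily.
    rcases hT.exchange hρ hext hxy with h | h
    · exact (hT.branchValue_le hρ h.1 h.2).2 heq
    · have := (hT.branchValue_le hρ (p := x) (x := y) (q := y) (y := x) h.1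
        (fun a ha b hb => h.2 b hb a ha)).2 heq.symm
      exact ⟨this.1.symm, fun a ha b hb => (this.2 b hb a ha).symm⟩
  refine isBranch_node.2 ⟨(T.away y x).toList, Finset.nodup_toList _, by simp,
    List.forall₂_iff_get.2 ⟨?_, ?_⟩⟩
  · rw [Finset.length_toList, ← key.1, ← e1, hts.length_eq]
  · intro i hi hi'
    have hil : i < l.length := hts.length_eq ▸ hi'
    have hx : l[i] ∈ T.away x y := (hmem _).1 (List.getElem_mem _)
    have hy : (T.away y x).toList[i] ∈ T.away y x :=
      Finset.mem_toList.1 (List.getElem_mem _)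
    obtain ⟨hne, h1, h2⟩ := hT.away_pair hxy hx hy
    have hb : IsBranch T x l[i] ts[i] := (List.forall₂_iff_get.1 hts).2 i hil hi'
    refine (ih ts[i] (List.getElem_mem _) hne (hb.congr h1.symm) ?_).congr h2
    obtain ⟨u, hu⟩ := hT.exists_isBranch y (T.away y x).toList[i]
    rw [← (hb.congr h1.symm).value_eq hρ, ← (hu.congr h2.symm).value_eq hρ, hb.value_eq hρ,
      hu.value_eq hρ]
    exact key.2 _ hx _ hy

end SimpleGraph

/-! ### Assembling a tree from its low and high branches -/

universe u

/-- `Assembles D L H F`: the tree `F` can be put together from inner vertices with degrees `D`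
(in non-decreasing order), low branches `L` and high branches `H`. In each step, either a vertex of
the last degree in `D` is joined to the last branches of `H`, which gives a new low branch, or
a vertex of the first degree in `D` is joined to the last branches of `L`, which gives a new high
branch. -/
inductive Assembles : List ℕ → List RTree → List RTree → RTree → Prop
  | done (d : ℕ) (ls hs : List RTree) (h : ls.length + hs.length = d) :
      Assembles [d] ls hs (node (ls ++ hs))
  | low {ds : List ℕ} {d : ℕ} {ls hs : List RTree} (b : List RTree) {F : RTree}
      (hb : b.length + 1 = d) (hds : ds ≠ []) (h : Assembles ds (node b :: ls) hs F) :
      Assembles (ds ++ [d]) ls (hs ++ b) F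
  | high {ds : List ℕ} {d : ℕ} {ls hs : List RTree} (b : List RTree) {F : RTree}
      (hb : b.length + 1 = d) (hds : ds ≠ []) (h : Assembles ds ls (node b :: hs) F) :
      Assembles (d :: ds) (ls ++ b) hs F

/-- This is the handshake count for trees. It is used throughout to see that enough branches are
available, and at the end to see that the number of leaves depends on the degrees alone. -/
lemma Assembles.length_add {D : List ℕ} {L H : List RTree} {F : RTree} (h : Assembles D L H F) :
    L.length + H.length + 2 * D.length = D.sum + 2 := by
  induction h with
  | done d ls hs h => simp; omega
  | low b hb hds h ih => simp at ih ⊢; omega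
  | high b hb hds h ih => simp at ih ⊢; omega

lemma two_mul_length_le_sum (m : List ℕ) (h : ∀ x ∈ m, 2 ≤ x) : 2 * m.length ≤ m.sum := by
  induction m with
  | nil => simp
  | cons x m ih =>
    have h1 := ih fun y hy => h y (by simp [hy])
    have h2 := h x (by simp)
    simp; omega

/-- An assembly never gets stuck: when there are too few low branches for a high step, the count
guarantees enough high branches for a low step. Confluence needs this to continue after both steps
have been made. -/
lemma Assembles.exists {D : List ℕ} (hD : D ≠ []) (h2 : ∀ d ∈ D, 2 ≤ d) {L H : List RTree}
    (h : L.length + H.length + 2 * D.length = D.sum + 2) : ∃ F, Assembles D L H F := by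
  induction hn : D.length generalizing D L H with
  | zero => exact absurd (List.length_eq_zero_iff.1 hn) hD
  | succ n ih =>
    obtain ⟨d, D', rfl⟩ := List.exists_cons_of_ne_nil hD
    by_cases hD' : D' = []
    · subst hD'
      simp at h
      exact ⟨_, .done d L H (by omega)⟩
    · have hsplit : ∀ (k : ℕ) (l : List RTree), k ≤ l.length →
          ∃ l₁ l₂, l = l₁ ++ l₂ ∧ l₂.length = k := fun k l hk =>
        ⟨l.take (l.length - k), l.drop (l.length - k), (List.take_append_drop _ _).symm,
          by simp; omega⟩
      by_cases hL : d - 1 ≤ L.length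
      · obtain ⟨ls, b, rfl, hb⟩ := hsplit _ _ hL
        have hd := h2 d (by simp)
        obtain ⟨F, hF⟩ := ih (D := D') hD' (fun x hx => h2 x (by simp [hx]))
          (L := ls) (H := node b :: H) (by simp at h ⊢; omega) (by simpa using hn)
        exact ⟨F, .high b (by omega) hD' hF⟩
      · obtain ⟨m, e, rfl⟩ : ∃ m e, D' = m ++ [e] :=
          ⟨_, _, (List.dropLast_append_getLast hD').symm⟩
        have hd := h2 d (by simp)
        have he := h2 e (by simp)
        have hm' := two_mul_length_le_sum m fun x hx => h2 x (by simp [hx])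
        simp at h
        obtain ⟨hs, b, rfl, hb⟩ := hsplit (e - 1) H (by omega)
        simp at h
        obtain ⟨F, hF⟩ := ih (D := d :: m) (by simp) (fun x hx => h2 x (by
            rcases List.mem_cons.1 hx with rfl | hx <;> simp [*]))
          (L := node b :: L) (H := hs) (by simp; omega) (by simpa using hn)
        exact ⟨F, .low (ds := d :: m) b (by omega) (by simp) hF⟩

lemma Assembles.cases_eq {D : List ℕ} {L H : List RTree} {F : RTree} (h : Assembles D L H F) :
    (∃ d, D = [d] ∧ L.length + H.length = d ∧ F = node (L ++ H)) ∨
    (∃ ds d hs b, D = ds ++ [d] ∧ H = hs ++ b ∧ b.length + 1 = d ∧ ds ≠ [] ∧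
      Assembles ds (node b :: L) hs F) ∨
    (∃ ds d ls b, D = d :: ds ∧ L = ls ++ b ∧ b.length + 1 = d ∧ ds ≠ [] ∧
      Assembles ds ls (node b :: H) F) := by
  cases h with
  | done d ls hs h => exact Or.inl ⟨d, rfl, h, rfl⟩
  | low b hb hds h => exact Or.inr (Or.inl ⟨_, _, _, _, rfl, rfl, hb, hds, h⟩)
  | high b hb hds h => exact Or.inr (Or.inr ⟨_, _, _, _, rfl, rfl, hb, hds, h⟩)

/-! ### Confluence of the assembly. -/

/-- Two rooted trees represent the same unrooted trees. -/
def SameUnrooted (F F' : RTree) : Prop :=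
  ∀ (V : Type u) [Fintype V] (T : SimpleGraph V), T.IsTree →
    ((∃ v, T.IsBranch v v F) ↔ ∃ v, T.IsBranch v v F')

/-- The result of the assembly does not depend on the order of the steps. -/
theorem Assembles.sameUnrooted {D : List ℕ} (h2 : ∀ d ∈ D, 2 ≤ d) {L H : List RTree} {F F' : RTree}
    (hF : Assembles D L H F) (hF' : Assembles D L H F') : SameUnrooted.{u} F F' := by
  induction hn : D.length using Nat.strong_induction_on generalizing D L H F F' with
  | _ n ih =>
  -- Low and high steps use disjoint resources, so they commute as long as a third vertex remains.
  have mixed : ∀ {F F' : RTree}, (∃ ds d hs b, D = ds ++ [d] ∧ H = hs ++ b ∧ b.length + 1 = d ∧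
        ds ≠ [] ∧ Assembles ds (node b :: L) hs F) →
      (∃ ds d ls b, D = d :: ds ∧ L = ls ++ b ∧ b.length + 1 = d ∧ ds ≠ [] ∧
        Assembles ds ls (node b :: H) F') → SameUnrooted.{u} F F' := by
    rintro F F' ⟨ds, d, hs, b, rfl, rfl, hb, hds, h⟩ ⟨ds', d', ls, b', hD, rfl, hb', hds', h'⟩
    obtain ⟨d'', m, rfl⟩ := List.exists_cons_of_ne_nil hds
    simp only [List.cons_append, List.cons.injEq] at hD
    obtain ⟨rfl, rfl⟩ := hD
    by_cases hm : m = []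
    · subst hm
      have c1 := h.length_add
      simp at c1
      -- With only two vertices left, all branches are used up by them, and the two results are the
      -- same tree rooted at either end of the last edge.
      obtain rfl : ls = [] := List.length_eq_zero_iff.1 (by omega)
      obtain rfl : hs = [] := List.length_eq_zero_iff.1 (by omega)
      rcases h.cases_eq with ⟨_, _, _, rfl⟩ | ⟨ds, _, _, _, hD, _, _, hds, _⟩ |
        ⟨ds, _, _, _, hD, _, _, hds, _⟩
      · rcases h'.cases_eq with ⟨_, _, _, rfl⟩ | ⟨ds, _, _, _, hD, _, _, hds, _⟩ |
          ⟨ds, _, _, _, hD, _, _, hds, _⟩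
        · intro V _ T hT
          simp only [List.nil_append, List.append_nil]
          exact ⟨fun ⟨v, hv⟩ => hv.reroot hT, fun ⟨v, hv⟩ => hv.reroot hT⟩
        · have := congrArg List.length hD
          simp at this
          exact absurd this hds
        · simp at hD
          exact absurd hD.2.symm (by simpa using hds.symm)
      · have := congrArg List.length hD
        simp at this
        exact absurd this hds
      · simp at hD
        exact absurd hD.2.symm (by simpa using hds.symm)
    · have c1 := h.length_add
      simp at c1
      -- A common continuation `G` after both steps closes the diamond; the induction compares each
      -- side with it.
      obtain ⟨G, hG⟩ := Assembles.exists hm (fun x hx => h2 x (by simp [hx]))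
        (L := node b :: ls) (H := node b' :: hs) (by simp; omega)
      have g1 : Assembles (d'' :: m) (node b :: (ls ++ b')) hs G := .high b' hb' hm hG
      have g2 : Assembles (m ++ [d]) ls (node b' :: (hs ++ b)) G := .low b hb hm hG
      have i1 := ih _ (by rw [← hn]; simp) (fun x hx => h2 x (by
        rcases List.mem_cons.1 hx with rfl | hx <;> simp [*])) h g1 rfl
      have i2 := ih _ (by rw [← hn]; simp) (fun x hx => h2 x (by
        rcases List.mem_append.1 hx with hx | hx <;> simp_all)) h' g2 rfl
      intro V _ T hT
      rw [i1 V T hT, i2 V T hT]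
  rcases hF.cases_eq with ⟨d, rfl, hd, rfl⟩ | h | h
  · rcases hF'.cases_eq with ⟨_, _, _, rfl⟩ | ⟨ds, _, _, _, hD, _, _, hds, _⟩ |
      ⟨ds, _, _, _, hD, _, _, hds, _⟩
    · exact fun V _ T hT => Iff.rfl
    · have := congrArg List.length hD
      simp at this
      exact absurd this hds
    · simp at hD
      exact absurd hD.2 hds
  · rcases hF'.cases_eq with ⟨d, rfl, _, rfl⟩ | h' | h'
    · obtain ⟨ds, _, _, _, hD, _, _, hds, _⟩ := h
      have := congrArg List.length hD
      simp at this
      exact absurd this hds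
    · obtain ⟨ds, d, hs, b, rfl, rfl, hb, hds, h⟩ := h
      obtain ⟨ds', d', hs', b', hD, hH, hb', hds', h'⟩ := h'
      obtain ⟨rfl, hd⟩ := List.append_inj' hD rfl
      simp only [List.cons.injEq, and_true] at hd
      subst hd
      obtain ⟨rfl, rfl⟩ := List.append_inj' hH (by omega)
      exact ih _ (by rw [← hn]; simp) (fun x hx => h2 x (by simp [hx])) h h' rfl
    · exact mixed h h'
  · rcases hF'.cases_eq with ⟨d, rfl, _, rfl⟩ | h' | h'
    · obtain ⟨ds, _, _, _, hD, _, _, hds, _⟩ := h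
      simp at hD
      exact absurd hD.2 hds
    · exact fun V _ T hT => (mixed h' h V T hT).symm
    · obtain ⟨ds, d, ls, b, rfl, rfl, hb, hds, h⟩ := h
      obtain ⟨ds', d', ls', b', hD, hL, hb', hds', h'⟩ := h'
      simp only [List.cons.injEq] at hD
      obtain ⟨rfl, rfl⟩ := hD
      obtain ⟨rfl, rfl⟩ := List.append_inj' hL (by omega)
      exact ih _ (by rw [← hn]; simp) (fun x hx => h2 x (by simp [hx])) h h' rfl

/-! ### Filling the leaves at the labelled vertices of an `M`-tree -/

namespace RTree

lemma sub?_append (a b : List ℕ) (t : RTree) : sub? (a ++ b) t = (sub? a t).bind (sub? b) := by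
  induction a generalizing t with
  | nil => rfl
  | cons i a ih =>
    obtain ⟨ts⟩ := t
    rw [List.cons_append, sub?_cons_node, sub?_cons_node]
    cases ts[i]? with
    | none => rfl
    | some u => exact ih u

lemma graft_append {a : List ℕ} (b : List ℕ) {t u : RTree} (X : RTree) (h : sub? a t = some u) :
    graft (a ++ b) t X = graft a t (graft b u X) := by
  induction a generalizing t with
  | nil => rw [← Option.some.inj h]; rfl
  | cons i a ih =>
    obtain ⟨ts⟩ := t
    rw [sub?_cons_node] at h
    rw [List.cons_append, graft_cons_node, graft_cons_node]
    congr 1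
    refine List.ext_getElem (by simp) fun j hj hj' => ?_
    rw [List.getElem_modify, List.getElem_modify]
    split_ifs with hij
    · subst hij
      rw [List.length_modify] at hj
      rw [List.getElem?_eq_getElem hj] at h
      exact ih h
    · rfl

lemma graft_comm {a b : List ℕ} (hab : ¬ a <+: b) (hba : ¬ b <+: a) (t X Y : RTree) :
    graft a (graft b t X) Y = graft b (graft a t Y) X := by
  induction a generalizing b t with
  | nil => exact absurd (List.nil_prefix) hab
  | cons i a ih =>
    cases b with
    | nil => exact absurd (List.nil_prefix) hba
    | cons j b =>
      obtain ⟨ts⟩ := t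
      simp only [graft_cons_node]
      congr 1
      by_cases hij : i = j
      · subst hij
        rw [List.modify_modify_eq, List.modify_modify_eq]
        congr 1
        funext u
        exact ih (fun h => hab (List.cons_prefix_cons.2 ⟨rfl, h⟩))
          (fun h => hba (List.cons_prefix_cons.2 ⟨rfl, h⟩)) u
      · rw [List.modify_modify_ne _ _ _ hij]

/-- The number of branches at the vertex with address `a`. -/
def branchCount? (a : List ℕ) (t : RTree) : Option ℕ := (sub? a t).map fun u => u.branches.length

lemma branchCount?_graft {a b : List ℕ} (h : ¬ a <+: b) (t X : RTree) :
    branchCount? b (graft a t X) = branchCount? b t := by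
  induction b generalizing a t with
  | nil =>
    cases a with
    | nil => exact absurd (List.nil_prefix) h
    | cons i a =>
      obtain ⟨ts⟩ := t
      simp [branchCount?, graft_cons_node, sub?, branches]
  | cons j b ih =>
    cases a with
    | nil => exact absurd (List.nil_prefix) h
    | cons i a =>
      obtain ⟨ts⟩ := t
      simp only [branchCount?] at ih ⊢
      rw [graft_cons_node, sub?_cons_node, sub?_cons_node]
      by_cases hij : i = j
      · subst hij
        rw [List.getElem?_modify_eq]
        cases ts[i]? with
        | none => rfl
        | some u => exact ih (fun h' => h (List.cons_prefix_cons.2 ⟨rfl, h'⟩)) u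
      · rw [List.getElem?_modify_ne _ _ hij]

/-- The addresses of the children of the vertex with address `a`. -/
def childAddresses (t : RTree) (a : List ℕ) : List (List ℕ) :=
  (List.range ((branchCount? a t).getD 0)).map fun i => a ++ [i]

/-- The addresses of the leaves among the children of the vertex with address `a`. -/
def slotsAt (t : RTree) (a : List ℕ) : List (List ℕ) :=
  (childAddresses t a).filter fun b => branchCount? b t == some 0

/-- The addresses of the leaves adjacent to the vertices with addresses in `lab`. -/
def slots (t : RTree) (lab : List (List ℕ)) : List (List ℕ) := lab.flatMap (slotsAt t)

/-- Replace the subtrees at the addresses in `σ` by the trees in `Hs`. -/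
def fill (t : RTree) (σ : List (List ℕ)) (Hs : List RTree) : RTree :=
  (σ.zip Hs).foldl (fun u p => graft p.1 u p.2) t

@[simp] lemma fill_nil (t : RTree) (Hs : List RTree) : fill t [] Hs = t := rfl

@[simp] lemma fill_cons (t : RTree) (a : List ℕ) (σ : List (List ℕ)) (B : RTree) (Hs : List RTree) :
    fill t (a :: σ) (B :: Hs) = fill (graft a t B) σ Hs := rfl

lemma fill_append (t : RTree) {σ : List (List ℕ)} {Hs : List RTree} (h : σ.length = Hs.length)
    (τ : List (List ℕ)) (Ks : List RTree) :
    fill t (σ ++ τ) (Hs ++ Ks) = fill (fill t σ Hs) τ Ks := by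
  rw [fill, List.zip_append h, List.foldl_append]; rfl

lemma branchCount?_eq_zero {a : List ℕ} {t : RTree} :
    branchCount? a t = some 0 ↔ sub? a t = some leaf := by
  unfold branchCount?
  cases h : sub? a t with
  | none => simp
  | some u =>
    obtain ⟨ts⟩ := u
    simp [branches, leaf]

lemma find?_range_eq_findIdx? {α : Type*} (p : α → Bool) (l : List α) :
    (List.range l.length).find? (fun i => (l[i]?).any p) = l.findIdx? p := by
  induction l with
  | nil => rfl
  | cons x l ih =>
    rw [List.length_cons, List.range_succ_eq_map, List.find?_cons, List.findIdx?_cons]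
    by_cases hx : p x
    · simp [hx]
    · simp only [List.getElem?_cons_zero, Option.any_some, hx, List.find?_map, ← ih]
      congr 1

lemma leafChild?_eq_head? (t : RTree) (a : List ℕ) : t.leafChild? a = (slotsAt t a).head? := by
  rw [slotsAt, List.head?_filter, childAddresses, List.find?_map, leafChild?]
  cases h : sub? a t with
  | none => simp [branchCount?, h]
  | some u =>
    obtain ⟨ts⟩ := u
    simp only [branchCount?, h, Option.map_some, Option.getD_some, Option.bind_some, branches]
    rw [← find?_range_eq_findIdx?]
    congr 2
    funext i
    simp only [Function.comp, sub?_append, h, Option.bind_some, sub?_cons_node]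
    cases ts[i]? with
    | none => rfl
    | some v =>
      obtain ⟨vs⟩ := v
      cases vs <;> simp [sub?]

/-- The recursion for the `M`-tree thus always grafts at the first slot, which is where the smallest
high branch belongs when the high branches are listed in increasing order. -/
lemma findSome?_leafChild? (t : RTree) (lab : List (List ℕ)) :
    lab.findSome? t.leafChild? = (slots t lab).head? := by
  rw [slots, List.head?_flatMap]
  congr 1
  funext a
  exact leafChild?_eq_head? t a

lemma mem_slotsAt {t : RTree} {a b : List ℕ} (h : b ∈ slotsAt t a) :
    (∃ i, b = a ++ [i]) ∧ sub? b t = some leaf := by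
  obtain ⟨h1, h2⟩ := List.mem_filter.1 h
  obtain ⟨i, -, rfl⟩ := List.mem_map.1 h1
  exact ⟨⟨i, rfl⟩, branchCount?_eq_zero.1 (by simpa using h2)⟩

lemma nodup_slots {t : RTree} {lab : List (List ℕ)} (h : lab.Nodup) : (slots t lab).Nodup := by
  rw [slots, List.nodup_flatMap]
  refine ⟨fun a _ => ?_, ?_⟩
  · refine List.Nodup.filter _ (List.Nodup.map ?_ List.nodup_range)
    intro i j hij
    simpa using hij
  · refine h.imp fun {a b} hab => ?_
    rw [Function.onFun, List.disjoint_left]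
    intro c hc hc'
    obtain ⟨⟨i, rfl⟩, -⟩ := mem_slotsAt hc
    obtain ⟨⟨j, hj⟩, -⟩ := mem_slotsAt hc'
    exact hab (List.append_inj_left' hj rfl)

lemma eq_of_prefix_of_leaf {a b : List ℕ} {t : RTree} (ha : sub? a t = some leaf)
    (hb : (sub? b t).isSome) (hab : a <+: b) : a = b := by
  obtain ⟨c, rfl⟩ := hab
  cases c with
  | nil => simp
  | cons i c =>
    rw [sub?_append, ha] at hb
    simp [leaf, sub?, branches] at hb

lemma slotsAt_graft {a b : List ℕ} {t X : RTree} (hX : X ≠ leaf) (ha : (sub? a t).isSome)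
    (hab : ¬ a <+: b) : slotsAt (graft a t X) b = (slotsAt t b).filter (· ≠ a) := by
  rw [slotsAt, slotsAt, childAddresses, branchCount?_graft hab, ← childAddresses, List.filter_filter]
  refine List.filter_congr fun c hc => ?_
  obtain ⟨i, -, rfl⟩ := List.mem_map.1 hc
  by_cases h : b ++ [i] = a
  · subst h
    have : branchCount? (b ++ [i]) (graft (b ++ [i]) t X) ≠ some 0 := by
      rw [Ne, branchCount?_eq_zero, sub?_graft_self _ _ ha]
      simpa using hX
    simp [this]
  · have h' : ¬ a <+: b ++ [i] := by
      rw [List.prefix_concat_iff]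
      rintro (h' | h')
      exacts [h h'.symm, hab h']
    rw [branchCount?_graft h']
    simp [h]

/-- Growing something at the first slot uses up exactly this slot among those of the old labels,
keeping the order of the rest. -/
lemma slots_graft {a : List ℕ} {lab σ : List (List ℕ)} {t X : RTree} (hX : X ≠ leaf)
    (ha : (sub? a t).isSome) (hab : ∀ b ∈ lab, ¬ a <+: b) (hlab : lab.Nodup)
    (hσ : slots t lab = a :: σ) : slots (graft a t X) lab = σ := by
  have h1 : slots (graft a t X) lab = (slots t lab).filter (· ≠ a) := by
    rw [slots, slots, List.filter_flatMap]
    exact List.flatMap_congr fun b hb => slotsAt_graft hX ha (hab b hb)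
  have h2 := nodup_slots (t := t) hlab
  rw [hσ] at h1 h2
  rw [h1, List.filter_cons_of_neg (by simp), List.filter_eq_self]
  intro c hc
  have : c ≠ a := by rintro rfl; exact (List.nodup_cons.1 h2).1 hc
  simpa using this

lemma slotsAt_append {a : List ℕ} (b : List ℕ) {t u : RTree} (h : sub? a t = some u) :
    slotsAt t (a ++ b) = (slotsAt u b).map (a ++ ·) := by
  have hc : ∀ c, branchCount? (a ++ c) t = branchCount? c u := fun c => by
    rw [branchCount?, sub?_append, h]; rfl
  rw [slotsAt, slotsAt, childAddresses, childAddresses, hc, List.filter_map, List.filter_map,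
    List.map_map]
  have e1 : ((fun b_1 => branchCount? b_1 t == some 0) ∘ fun i => a ++ b ++ [i]) =
      ((fun b => branchCount? b u == some 0) ∘ fun i => b ++ [i]) := by
    funext i
    simp [Function.comp, hc]
  rw [e1]
  refine List.map_congr_left fun i _ => ?_
  simp [Function.comp]

lemma fill_map_append {a : List ℕ} (σ : List (List ℕ)) (Hs : List RTree) {t u : RTree}
    (h : sub? a t = some u) : fill t (σ.map (a ++ ·)) Hs = graft a t (fill u σ Hs) := by
  induction σ generalizing t u Hs with
  | nil => rw [List.map_nil, fill_nil, fill_nil, graft_of_sub? a h]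
  | cons b σ ih =>
    cases Hs with
    | nil => exact (graft_of_sub? a h).symm
    | cons B Hs =>
      rw [List.map_cons, fill_cons, fill_cons, graft_append b B h,
        ih (u := graft b u B) Hs (sub?_graft_self a _ (by rw [h]; rfl)), graft_graft_self]

lemma fill_graft_comm {a : List ℕ} {σ : List (List ℕ)} (hσ : ∀ b ∈ σ, ¬ a <+: b ∧ ¬ b <+: a)
    (Hs : List RTree) (t X : RTree) : fill (graft a t X) σ Hs = graft a (fill t σ Hs) X := by
  induction σ generalizing t Hs with
  | nil => rfl
  | cons b σ ih =>
    cases Hs with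
    | nil => rfl
    | cons B Hs =>
      obtain ⟨h1, h2⟩ := hσ b (by simp)
      rw [fill_cons, fill_cons, graft_comm h2 h1, ih fun c hc => hσ c (by simp [hc])]

lemma fill_comm {σ τ : List (List ℕ)} (h : ∀ a ∈ τ, ∀ b ∈ σ, ¬ a <+: b ∧ ¬ b <+: a)
    (Hs Ks : List RTree) (t : RTree) : fill (fill t σ Hs) τ Ks = fill (fill t τ Ks) σ Hs := by
  induction τ generalizing t Ks with
  | nil => rfl
  | cons a τ ih =>
    cases Ks with
    | nil => rfl
    | cons B Ks =>
      rw [fill_cons, fill_cons, ← ih fun c hc => h c (by simp [hc]),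
        fill_graft_comm (h a (by simp))]

lemma fill_replicate_leaf {σ : List (List ℕ)} {t : RTree} (h : ∀ a ∈ σ, sub? a t = some leaf)
    (n : ℕ) : fill t σ (List.replicate n leaf) = t := by
  induction σ generalizing n with
  | nil => rfl
  | cons a σ ih =>
    cases n with
    | zero => rfl
    | succ n =>
      rw [List.replicate_succ, fill_cons, graft_of_sub? a (h a (by simp)),
        ih fun b hb => h b (by simp [hb])]

/-! ### Stars -/

/-- The addresses of the leaves of stars with sizes `es` that are the branches number
`k, k + 1, …` of a rooted tree. -/
def starSlots : ℕ → List ℕ → List (List ℕ)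
  | _, [] => []
  | k, e :: es => (List.range (e - 1)).map (fun i => [k, i]) ++ starSlots (k + 1) es

lemma sub?_singleton_append (P Q : List RTree) (u : RTree) :
    sub? [P.length] (node (P ++ u :: Q)) = some u := by
  simp [sub?, branches]

lemma graft_singleton_append (P Q : List RTree) (u X : RTree) :
    graft [P.length] (node (P ++ u :: Q)) X = node (P ++ X :: Q) := by
  rw [graft_cons_node]
  congr 1
  induction P with
  | nil => rfl
  | cons p P ih => simpa using ih

lemma slotsAt_root (P : List RTree) (hP : ∀ u ∈ P, u ≠ leaf) (n : ℕ) :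
    slotsAt (node (P ++ List.replicate n leaf)) [] =
      (List.range n).map fun i => [P.length + i] := by
  have hc : branchCount? [] (node (P ++ List.replicate n leaf)) = some (P.length + n) := by
    simp [branchCount?, sub?, branches]
  rw [slotsAt, childAddresses, hc, Option.getD_some, List.range_add, List.map_append,
    List.filter_append]
  rw [List.filter_eq_nil_iff.2, List.filter_eq_self.2]
  · simp
  · intro a ha
    simp only [List.map_map, List.mem_map, List.mem_range, Function.comp] at ha
    obtain ⟨i, hi, rfl⟩ := ha
    rw [beq_iff_eq, branchCount?_eq_zero]
    simp [sub?, branches, hi]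
  · intro a ha
    simp only [List.mem_map, List.mem_range] at ha
    obtain ⟨i, hi, rfl⟩ := ha
    rw [beq_iff_eq, branchCount?_eq_zero]
    simp only [List.nil_append, sub?, branches, List.getElem?_append_left hi,
      List.getElem?_eq_getElem hi, Option.bind_some, Option.some.injEq]
    exact hP _ (List.getElem_mem _)

lemma fill_root (b P : List RTree) :
    fill (node (P ++ List.replicate b.length leaf))
      ((List.range b.length).map fun i => [P.length + i]) b = node (P ++ b) := by
  induction b generalizing P with
  | nil => rfl
  | cons x b ih =>
    have := ih (P ++ [x])
    rw [List.length_cons, List.replicate_succ, List.range_succ_eq_map, List.map_cons, fill_cons,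
      add_zero, graft_singleton_append, List.map_map]
    simp only [List.append_assoc, List.singleton_append, List.length_append, List.length_singleton]
      at this
    rw [← this]
    congr 2
    funext i
    simp [Function.comp]
    omega

lemma slots_stars (es : List ℕ) (P ws : List RTree) :
    slots (node (P ++ (es.map star ++ ws))) ((List.range es.length).map fun j => [P.length + j]) =
      starSlots P.length es := by
  induction es generalizing P with
  | nil => rfl
  | cons e es ih =>
    have := ih (P ++ [star e])
    simp only [List.append_assoc, List.singleton_append, List.length_append, List.length_singleton]
      at this
    rw [starSlots, ← this, List.length_cons, List.range_succ_eq_map, List.map_cons, List.map_cons,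
      slots, List.flatMap_cons, ← slots]
    congr 1
    · have h1 := slotsAt_append [] (sub?_singleton_append P (es.map star ++ ws) (star e))
      have h2 := slotsAt_root [] (by simp) (e - 1)
      rw [List.nil_append] at h2
      rw [star, h2] at h1
      simpa [star, Function.comp_def] using h1
    · rw [List.map_map, List.cons_append]
      congr 1
      refine List.map_congr_left fun i _ => ?_
      simp
      omega

lemma fill_stars (bs : List (List RTree)) (P ws : List RTree) :
    fill (node (P ++ ((bs.map fun b => b.length + 1).map star ++ ws)))
      (starSlots P.length (bs.map fun b => b.length + 1)) bs.flatten =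
        node (P ++ (bs.map node ++ ws)) := by
  induction bs generalizing P with
  | nil => rfl
  | cons b bs ih =>
    rw [List.map_cons, starSlots, List.flatten_cons, fill_append _ (by simp), List.map_cons,
      List.cons_append]
    have h1 := fill_map_append ((List.range b.length).map fun i => [i]) b
      (sub?_singleton_append P ((bs.map fun b => b.length + 1).map star ++ ws)
        (star (b.length + 1)))
    have h2 := fill_root b []
    simp only [List.nil_append, List.length_nil, zero_add] at h2
    have h3 : star (b.length + 1) = node (List.replicate b.length leaf) := rfl
    rw [h3, h2, List.map_map (l := List.range b.length)] at h1
    have h4 : ((List.range (b.length + 1 - 1)).map fun i => [P.length, i]) =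
        (List.range b.length).map ((fun x => [P.length] ++ x) ∘ fun i => [i]) := by
      simp
    rw [h4, h3, h1, graft_singleton_append]
    have := ih (P ++ [node b])
    simp only [List.append_assoc, List.singleton_append, List.length_append, List.length_singleton]
      at this
    rw [this]
    rfl

lemma exists_blocks (k : ℕ) (es : List ℕ) (h : ∀ e ∈ es, 2 ≤ e) (Hs : List RTree)
    (hlen : Hs.length = (starSlots k es).length) :
    ∃ bs : List (List RTree), bs.map (fun b => b.length + 1) = es ∧ bs.flatten = Hs := by
  induction es generalizing k Hs with
  | nil => exact ⟨[], rfl, (List.length_eq_zero_iff.1 hlen).symm⟩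
  | cons e es ih =>
    simp only [starSlots, List.length_append, List.length_map, List.length_range] at hlen
    obtain ⟨bs, h1, h2⟩ := ih (k + 1) (fun x hx => h x (by simp [hx])) (Hs.drop (e - 1))
      (by simp; omega)
    have he := h e (by simp)
    refine ⟨Hs.take (e - 1) :: bs, ?_, ?_⟩
    · simp [h1]; omega
    · simp [h2]

end RTree

/-! ### Assembling an `M`-tree -/

/-- A run of consecutive low steps: the largest degree takes the last block, the next one the block
before it, and so on. -/
lemma Assembles.low_blocks {ds : List ℕ} (hds : ds ≠ []) (bs : List (List RTree)) :
    ∀ {L H : List RTree} {F : RTree}, Assembles ds (bs.map node ++ L) H F →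
      Assembles (ds ++ bs.map fun b => b.length + 1) L (H ++ bs.flatten) F := by
  induction bs using List.reverseRecOn with
  | nil => intro L H F h; simpa using h
  | append_singleton bs b ih =>
    intro L H F h
    have h1 := ih (L := node b :: L) (H := H) (F := F) (by simpa using h)
    have h2 := Assembles.low (d := b.length + 1) b rfl (by simp [hds]) h1
    simpa using h2

/-- For the induction, the leaves at the labelled vertices must be replaceable by arbitrary trees
`Hs`, in the order of the labels: the smaller `M`-tree is used with a nontrivial tree in its first
slot. The first two claims keep the slots distinct and apart from the labelled vertices. -/
lemma mTreeLabelled_assembles (D : List ℕ) (hD : D ≠ []) (h2 : ∀ d ∈ D, 2 ≤ d) :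
    (∀ a ∈ (mTreeLabelled D).2, ∃ u, sub? a (mTreeLabelled D).1 = some u ∧ u ≠ leaf) ∧
    (mTreeLabelled D).2.Nodup ∧
    ∀ Hs : List RTree, Hs.length = (slots (mTreeLabelled D).1 (mTreeLabelled D).2).length →
      Assembles D [] Hs
        (fill (mTreeLabelled D).1 (slots (mTreeLabelled D).1 (mTreeLabelled D).2) Hs) := by
  have hstar : ∀ e, 2 ≤ e → RTree.star e ≠ leaf := by
    intro e he
    simp [RTree.star, leaf]
    omega
  induction hn : D.length using Nat.strong_induction_on generalizing D with
  | _ n ih =>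
  obtain ⟨d, es, rfl⟩ := List.exists_cons_of_ne_nil hD
  have hes : ∀ e ∈ es, 2 ≤ e := fun e he => h2 e (by simp [he])
  have hd : 2 ≤ d := h2 d (by simp)
  rw [mTreeLabelled]
  by_cases hle : es.length ≤ d
  · simp only [if_pos hle]
    refine ⟨?_, ?_, ?_⟩
    · intro a ha
      rcases List.mem_cons.1 ha with rfl | ha
      · refine ⟨_, rfl, ?_⟩
        simp only [leaf, ne_eq, node.injEq]
        intro h
        have := congrArg List.length h
        simp at this
        obtain ⟨h3, h4⟩ := this
        subst h3
        simp at h4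
        omega
      · obtain ⟨j, hj, rfl⟩ := List.mem_map.1 ha
        rw [List.mem_range] at hj
        refine ⟨RTree.star es[j], ?_, hstar _ (hes _ (List.getElem_mem _))⟩
        simp [sub?, branches, List.getElem?_append_left, hj]
    · refine List.nodup_cons.2 ⟨by simp, List.Nodup.map (fun i j h => by simpa using h)
        List.nodup_range⟩
    · have hslots : slots (node (es.map RTree.star ++ List.replicate (d - es.length) leaf))
          ([] :: (List.range es.length).map fun j => [j]) =
            ((List.range (d - es.length)).map fun i => [es.length + i]) ++ starSlots 0 es := by
        have h3 := slotsAt_root (es.map RTree.star) (by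
          intro u hu
          obtain ⟨e, he, rfl⟩ := List.mem_map.1 hu
          exact hstar e (hes e he)) (d - es.length)
        have h4 := slots_stars es [] (List.replicate (d - es.length) leaf)
        simp only [List.length_map] at h3
        simp only [List.nil_append, List.length_nil, zero_add] at h4
        rw [slots, List.flatMap_cons, h3, ← slots, h4]
      rw [hslots]
      intro Hs hHs
      rw [List.length_append, List.length_map, List.length_range] at hHs
      obtain ⟨Hr, Hl, rfl, hr⟩ : ∃ Hr Hl, Hs = Hr ++ Hl ∧ Hr.length = d - es.length :=
        ⟨Hs.take (d - es.length), Hs.drop (d - es.length), (List.take_append_drop _ _).symm,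
          by simp; omega⟩
      rw [List.length_append, hr] at hHs
      obtain ⟨bs, rfl, rfl⟩ := exists_blocks 0 es hes Hl (by omega)
      rw [fill_append _ (by simp [hr]), ← hr]
      have h3 := fill_root Hr ((bs.map fun b => b.length + 1).map RTree.star)
      simp only [List.length_map] at h3 ⊢
      rw [h3]
      have h4 := fill_stars bs [] Hr
      simp only [List.nil_append, List.length_nil] at h4
      rw [h4]
      -- All degrees except the smallest are used in low steps, and the last vertex collects the
      -- resulting branches together with `Hr`.
      have h5 := Assembles.low_blocks (ds := [d]) (by simp) bs (L := []) (H := Hr)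
        (F := node (bs.map node ++ Hr)) (by
          simpa using Assembles.done d (bs.map node) Hr (by
            simp only [List.length_map] at hr hle ⊢; omega))
      simpa using h5
  · simp only [if_neg hle]
    obtain ⟨D', outer, hes', hD'⟩ : ∃ D' outer, es.take (es.length - (d - 1)) = D' ∧
      es.drop (es.length - (d - 1)) = outer := ⟨_, _, rfl, rfl⟩
    have hsplit : es = D' ++ outer := by rw [← hes', ← hD', List.take_append_drop]
    have hlen : outer.length = d - 1 := by rw [← hD', List.length_drop]; omega
    rw [hes', hD']
    have hD'0 : D' ≠ [] := by
      intro h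
      rw [h, List.nil_append] at hsplit
      rw [hsplit] at hle
      omega
    have houter : ∀ e ∈ outer, 2 ≤ e := fun e he => hes e (by simp [hsplit, he])
    obtain ⟨i1, i2, i3⟩ := ih D'.length (by rw [← hn, hsplit]; simp) D' hD'0
      (fun e he => hes e (by simp [hsplit, he])) rfl
    generalize mTreeLabelled D' = M at i1 i2 i3
    obtain ⟨t, lab⟩ := M
    simp only at i1 i2 i3 ⊢
    rw [findSome?_leafChild?]
    have hcount := (i3 (List.replicate _ leaf) List.length_replicate).length_add
    cases hσ : slots t lab with
    | nil =>
      -- By the count for the smaller tree, it has at least two slots, since all degrees are at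
      -- least 2.
      exfalso
      rw [hσ] at hcount
      have := two_mul_length_le_sum D' fun e he => hes e (by simp [hsplit, he])
      simp at hcount
      omega
    | cons a₀ σ =>
    simp only [List.head?_cons]
    have hleafs : ∀ b ∈ slots t lab, sub? b t = some leaf := by
      intro b hb
      obtain ⟨c, hc, hb⟩ := List.mem_flatMap.1 hb
      exact (mem_slotsAt hb).2
    have ha₀ : sub? a₀ t = some leaf := hleafs a₀ (by simp [hσ])
    have hnodup := nodup_slots (t := t) i2
    rw [hσ] at hnodup i3 hleafs
    have hpre : ∀ b ∈ lab, ¬ a₀ <+: b := by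
      intro b hb hab
      obtain ⟨u, hu, hu'⟩ := i1 b hb
      have := eq_of_prefix_of_leaf ha₀ (by rw [hu]; rfl) hab
      subst this
      rw [ha₀] at hu
      exact hu' (Option.some.inj hu).symm
    have houter0 : outer ≠ [] := by rintro rfl; simp at hlen; omega
    have hB : node (outer.map RTree.star) ≠ leaf := by simpa [leaf] using houter0
    have hsome : (sub? a₀ t).isSome := by rw [ha₀]; rfl
    have hsub := sub?_graft_self a₀ (node (outer.map RTree.star)) hsome
    refine ⟨?_, ?_, ?_⟩
    · intro b hb
      rcases List.mem_append.1 hb with hb | hb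
      · obtain ⟨u, hu, hu'⟩ := i1 b hb
        have h3 := branchCount?_graft (hpre b hb) t (node (outer.map RTree.star))
        have h4 : branchCount? b t ≠ some 0 := by
          rw [Ne, branchCount?_eq_zero, hu]
          simpa using hu'
        rw [← h3, Ne, branchCount?_eq_zero] at h4
        rw [branchCount?, branchCount?, hu] at h3
        cases h5 : sub? b (graft a₀ t (node (outer.map RTree.star))) with
        | none => rw [h5] at h3; simp at h3
        | some v => exact ⟨v, rfl, fun h => h4 (by rw [h5, h])⟩
      · obtain ⟨j, hj, rfl⟩ := List.mem_map.1 hb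
        rw [List.mem_range] at hj
        refine ⟨RTree.star outer[j], ?_, hstar _ (houter _ (List.getElem_mem _))⟩
        rw [sub?_append, hsub]
        simp [sub?, branches, hj]
    · rw [List.nodup_append]
      refine ⟨i2, List.Nodup.map (fun i j h => by simpa using h) List.nodup_range, ?_⟩
      rintro b hb c hc rfl
      obtain ⟨j, -, rfl⟩ := List.mem_map.1 hc
      exact hpre _ hb (List.prefix_append _ _)
    · have hslots : slots (graft a₀ t (node (outer.map RTree.star)))
          (lab ++ (List.range outer.length).map fun j => a₀ ++ [j]) =
            σ ++ (starSlots 0 outer).map (a₀ ++ ·) := by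
        have h3 := slots_graft hB hsome hpre i2 hσ
        have h4 := slots_stars outer [] []
        simp only [List.nil_append, List.length_nil, zero_add, List.append_nil] at h4
        rw [slots, List.flatMap_append, ← slots, h3, ← h4, slots, List.map_flatMap,
          List.flatMap_map, List.flatMap_map]
        congr 1
        exact List.flatMap_congr fun j _ => slotsAt_append [j] hsub
      rw [hslots]
      intro Hs hHs
      rw [List.length_append, List.length_map] at hHs
      obtain ⟨Hf, Hl, rfl, hf⟩ : ∃ Hf Hl, Hs = Hf ++ Hl ∧ Hf.length = σ.length :=
        ⟨Hs.take σ.length, Hs.drop σ.length, (List.take_append_drop _ _).symm, by simp; omega⟩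
      rw [List.length_append, hf] at hHs
      obtain ⟨bs, hbs, rfl⟩ := exists_blocks 0 outer houter Hl (by omega)
      -- The high branch made of the outer blocks goes into the first slot `a₀` of the smaller tree.
      have h3 := i3 (node (bs.map node) :: Hf) (by simp [hf])
      rw [fill_cons] at h3
      -- The slots of the outer stars lie below `a₀` and the slots in `σ` do not, so the stars can
      -- be filled first, turning the grafted piece into the high branch of `h3`.
      rw [fill_append _ hf.symm, fill_comm ?_, fill_map_append _ _ hsub, graft_graft_self]
      · have h4 := fill_stars bs [] []
        simp only [List.nil_append, List.length_nil, List.append_nil] at h4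
        rw [hbs] at h4
        rw [h4]
        -- Reading the assembly forwards, `d - 1` low steps produce the branches `bs.map node`, and
        -- the vertex of smallest degree `d` joins them in a high step.
        have h5 : Assembles (d :: D') ([] ++ bs.map node) Hf _ :=
          Assembles.high (bs.map node) (by
            have := congrArg List.length hbs
            simp at this ⊢
            omega) hD'0 h3
        have h6 := Assembles.low_blocks (ds := d :: D') (by simp) bs (L := []) (by simpa using h5)
        rw [hbs] at h6
        rw [hsplit]
        exact h6
      · intro b hb c hc
        obtain ⟨b, -, rfl⟩ := List.mem_map.1 hb
        have hcl := hleafs c (by simp [hc])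
        have hne : a₀ ≠ c := by rintro rfl; exact (List.nodup_cons.1 hnodup).1 hc
        have hn1 : ¬ a₀ <+: c := fun h =>
          hne (eq_of_prefix_of_leaf ha₀ (by rw [hcl]; rfl) h)
        have hn2 : ¬ c <+: a₀ := fun h =>
          hne (eq_of_prefix_of_leaf hcl hsome h).symm
        refine ⟨fun h => hn1 ((List.prefix_append _ _).trans h), fun h => ?_⟩
        rcases List.prefix_or_prefix_of_prefix h (List.prefix_append a₀ b) with h | h
        exacts [hn2 h, hn1 h]

/-- The `M`-tree is assembled from its leaves. -/
theorem mTree_assembles {D : List ℕ} (hD : D ≠ []) (h2 : ∀ d ∈ D, 2 ≤ d) :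
    ∃ n, Assembles D [] (List.replicate n leaf) (mTree D) := by
  obtain ⟨-, -, h⟩ := mTreeLabelled_assembles D hD h2
  refine ⟨(slots (mTreeLabelled D).1 (mTreeLabelled D).2).length, ?_⟩
  have h1 := h (List.replicate _ leaf) List.length_replicate
  rw [fill_replicate_leaf] at h1
  · exact h1
  · intro b hb
    obtain ⟨c, hc, hb⟩ := List.mem_flatMap.1 hb
    exact (mem_slotsAt hb).2

/-! ### Contracting an exchange-extremal tree -/

namespace SimpleGraph

variable {V : Type*} [Fintype V] {T : SimpleGraph V} {R : V → V → ℝ} {g : V → ℤ}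

/-- The properties of the values `R p x` of the branches of an exchange-extremal tree, where `g`
measures the degrees. They are invariant under reversal of both orders. -/
structure ExchangeSystem (T : SimpleGraph V) (R : V → V → ℝ) (g : V → ℤ) : Prop where
  tree : T.IsTree
  exchange : ∀ v w, v ≠ w →
    (g w ≤ g v ∧ ∀ a ∈ T.away v w, ∀ b ∈ T.away w v, R w b ≤ R v a) ∨
    (g v ≤ g w ∧ ∀ a ∈ T.away v w, ∀ b ∈ T.away w v, R v a ≤ R w b)
  mono : ∀ p x q y, T.Adj p x → T.Adj q y → g y ≤ g x →
    (∀ a ∈ T.away x p, ∀ b ∈ T.away y q, R y b ≤ R x a) →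
    R p x ≤ R q y ∧
      (R p x = R q y → g x = g y ∧ ∀ a ∈ T.away x p, ∀ b ∈ T.away y q, R x a = R y b)
  card_eq : ∀ v w, g v = g w → (T.away v v).card = (T.away w w).card

/-- With this symmetry, statements about low tips and vertices of small degree follow from those
about high tips and vertices of large degree. It is why `g` is an abstract integer function rather
than the degree. -/
lemma ExchangeSystem.dual (h : ExchangeSystem T R g) : ExchangeSystem T (-R) (-g) where
  tree := h.tree
  exchange v w hvw := by
    simp only [Pi.neg_apply, neg_le_neg_iff]
    exact (h.exchange v w hvw).symm
  mono p x q y hpx hqy hg hle := by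
    simp only [Pi.neg_apply, neg_le_neg_iff, neg_inj] at *
    obtain ⟨h1, h2⟩ := h.mono q y p x hqy hpx hg fun a ha b hb => hle b hb a ha
    exact ⟨h1, fun heq => ⟨(h2 heq.symm).1.symm, fun a ha b hb => ((h2 heq.symm).2 b hb a ha).symm⟩⟩
  card_eq v w hg := h.card_eq v w (by simpa using hg)

/-- The vertex `a` has maximal degree in `S`, and all its neighbours except for `p` are high tips
whose values are at least those of all tips at other vertices. -/
def IsTop (T : SimpleGraph V) (R : V → V → ℝ) (g : V → ℤ) (S : Finset V) (Lo Hi : Finset (V × V))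
    (p a : V) : Prop :=
  (∀ s ∈ S, g s ≤ g a) ∧ ∀ c ∈ T.away a p, (a, c) ∈ Hi ∧
    ∀ w b, (w, b) ∈ Lo ∨ (w, b) ∈ Hi → w ≠ a → R w b ≤ R a c

/-- `S` is the vertex set of a subtree of `T`. The edges that lead out of `S`, the tips, are divided
into low tips `Lo` and high tips `Hi`, whose values lie below and above those of all
edges inside `S`. -/
structure ContractionState (T : SimpleGraph V) (R : V → V → ℝ) (g : V → ℤ) (S : Finset V)
    (Lo Hi : Finset (V × V)) : Prop where
  step_mem : ∀ v ∈ S, ∀ w ∈ S, ∀ a, T.Adj v a → T.dist a w + 1 = T.dist v w → a ∈ S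
  two_le : ∀ v ∈ S, 2 ≤ (T.away v v).card
  mem_or : ∀ v x, (v, x) ∈ Lo ∨ (v, x) ∈ Hi ↔ v ∈ S ∧ x ∉ S ∧ T.Adj v x
  disj : Disjoint Lo Hi
  lo_le : ∀ v x, (v, x) ∈ Lo → ∀ p ∈ S, ∀ a ∈ S, T.Adj p a → R v x ≤ R p a
  le_hi : ∀ v x, (v, x) ∈ Hi → ∀ p ∈ S, ∀ a ∈ S, T.Adj p a → R p a ≤ R v x
  tie_lo : ∀ p ∈ S, ∀ a ∈ S, T.Adj p a → ∀ v x, (v, x) ∈ Lo → R p a ≤ R v x →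
    IsTop T R g S Lo Hi p a
  tie_hi : ∀ p ∈ S, ∀ a ∈ S, T.Adj p a → ∀ v x, (v, x) ∈ Hi → R v x ≤ R p a →
    IsTop T (-R) (-g) S Hi Lo p a

/-! ### Top vertices, dominant vertices and the contraction step. -/

namespace ContractionState

variable {S : Finset V} {Lo Hi : Finset (V × V)}

lemma dual (h : ContractionState T R g S Lo Hi) : ContractionState T (-R) (-g) S Hi Lo where
  step_mem := h.step_mem
  two_le := h.two_le
  mem_or v x := by rw [or_comm]; exact h.mem_or v x
  disj := h.disj.symm
  lo_le v x hx p hp a ha hpa := neg_le_neg (h.le_hi v x hx p hp a ha hpa)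
  le_hi v x hx p hp a ha hpa := neg_le_neg (h.lo_le v x hx p hp a ha hpa)
  tie_lo p hp a ha hpa v x hx hle := h.tie_hi p hp a ha hpa v x hx (neg_le_neg_iff.1 hle)
  tie_hi p hp a ha hpa v x hx hle := by
    rw [neg_neg, neg_neg]
    exact h.tie_lo p hp a ha hpa v x hx (neg_le_neg_iff.1 hle)

/-- `S` is convex, so a step towards another vertex of `S` cannot leave it. -/
lemma mem_away_of_tip (h : ContractionState T R g S Lo Hi) (hT : T.IsTree) {v x w : V}
    (hv : v ∈ S) (hx : x ∉ S) (hvx : T.Adj v x) (hw : w ∈ S) : x ∈ T.away v w := by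
  rcases hT.away_or hvx w with h' | h'
  · exact h'
  · exact absurd (h.step_mem v hv w hw x hvx h') hx

lemma eq_of_isTop (h : ContractionState T R g S Lo Hi) (hT : T.IsTree) {p a q : V}
    (hpa : T.Adj p a) (htop : IsTop T R g S Lo Hi p a) (hq : q ∈ S) (hqa : T.Adj q a) : q = p := by
  by_contra hne
  have := (htop.2 q ((mem_away_of_adj hT hpa.symm).2 ⟨hqa.symm, hne⟩)).1
  exact ((h.mem_or a q).1 (Or.inr this)).2.1 hq

lemma le_of_isTop (h : ContractionState T R g S Lo Hi) {p a : V}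
    (htop : IsTop T R g S Lo Hi p a) {p' a' : V} (ha' : a' ∈ S) (hne : a' ≠ a) :
    ∀ c ∈ T.away a p, ∀ c' ∈ T.away a' p', R a' c' ≤ R a c := by
  intro c hc c' hc'
  have hadj := (mem_away.1 hc').1
  by_cases hcS : c' ∈ S
  · exact h.le_hi a c (htop.2 c hc).1 a' ha' c' hcS hadj
  · exact (htop.2 c hc).2 a' c' ((h.mem_or a' c').2 ⟨ha', hcS, hadj⟩) hne

/-- A top vertex has the largest degree and the largest sub-branches, so by monotonicity its branch
is the smallest inner one; this is why it may become a low tip. -/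
lemma value_le_of_isTop (h : ContractionState T R g S Lo Hi) (hE : ExchangeSystem T R g) {p a : V}
    (hpa : T.Adj p a) (htop : IsTop T R g S Lo Hi p a) {p' a' : V} (hp' : p' ∈ S) (ha' : a' ∈ S)
    (hpa' : T.Adj p' a') : R p a ≤ R p' a' := by
  by_cases hne : a' = a
  · subst hne
    rw [h.eq_of_isTop hE.tree hpa htop hp' hpa']
  · exact (hE.mono p a p' a' hpa hpa' (htop.1 a' ha') (h.le_of_isTop htop ha' hne)).1

/-- If `a'` differs from `a`, this is the equality case of monotonicity: the degrees agree and all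
sub-branches at both vertices have one common value, so the top property is inherited. -/
lemma isTop_of_le (h : ContractionState T R g S Lo Hi) (hE : ExchangeSystem T R g)
    (hstrict : ∀ v x, (v, x) ∈ Hi → ∀ p ∈ S, ∀ a ∈ S, T.Adj p a → R p a < R v x) {p a : V}
    (hp : p ∈ S) (ha : a ∈ S) (hpa : T.Adj p a) (htop : IsTop T R g S Lo Hi p a) {p' a' : V}
    (hp' : p' ∈ S) (ha' : a' ∈ S) (hpa' : T.Adj p' a') (hle : R p' a' ≤ R p a) :
    IsTop T R g S Lo Hi p' a' := by
  by_cases hne : a' = a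
  · subst hne
    rw [h.eq_of_isTop hE.tree hpa htop hp' hpa']
    exact htop
  obtain ⟨h1, h2⟩ := hE.mono p a p' a' hpa hpa' (htop.1 a' ha') (h.le_of_isTop htop ha' hne)
  obtain ⟨h3, h4⟩ := h2 (le_antisymm h1 hle)
  have hcard := hE.tree.card_away_add_one hpa.ne'
  have := h.two_le a ha
  obtain ⟨c, hc⟩ := Finset.card_pos.1 (show 0 < (T.away a p).card by omega)
  have hcHi := (htop.2 c hc).1
  refine ⟨fun s hs => h3 ▸ htop.1 s hs, fun c' hc' => ?_⟩
  have heq := h4 c hc c' hc'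
  have hadj := (mem_away.1 hc').1
  have hcS : c' ∉ S := fun hcS => by
    have := hstrict a c hcHi a' ha' c' hcS hadj
    linarith
  refine ⟨?_, fun w b hwb hwa' => ?_⟩
  · rcases (h.mem_or a' c').2 ⟨ha', hcS, hadj⟩ with h5 | h5
    · have h6 := h.lo_le a' c' h5 p hp a ha hpa
      have h7 := hstrict a c hcHi p hp a ha hpa
      linarith
    · exact h5
  · by_cases hwa : w = a
    · subst hwa
      obtain ⟨-, hbS, hwb'⟩ := (h.mem_or w b).1 hwb
      have hb : b ∈ T.away w p :=
        (mem_away_of_adj hE.tree hpa.symm).2 ⟨hwb', fun hbp => hbS (hbp ▸ hp)⟩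
      rw [h4 b hb c' hc']
    · rw [← heq]
      exact (htop.2 c hc).2 w b hwb hwa

open Classical in
/-- Contracting a top vertex turns it into a low tip. -/
theorem contract (h : ContractionState T R g S Lo Hi) (hE : ExchangeSystem T R g) {p a : V}
    (hp : p ∈ S) (ha : a ∈ S) (hpa : T.Adj p a) (htop : IsTop T R g S Lo Hi p a)
    (htie : ∀ p' ∈ S, ∀ a' ∈ S, T.Adj p' a' → R p' a' ≤ R p a → IsTop T R g S Lo Hi p' a') :
    ContractionState T R g (S.erase a) (insert (p, a) Lo)
      (Hi \ (T.away a p).image fun c => (a, c)) := by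
  have hT := hE.tree
  have hchild : ∀ x, x ∉ S → T.Adj a x → x ∈ T.away a p := fun x hx hax =>
    (mem_away_of_adj hT hpa.symm).2 ⟨hax, fun hxp => hx (hxp ▸ hp)⟩
  have hnew : ∀ w b, (w, b) ∈ insert (p, a) Lo ∨
      (w, b) ∈ Hi \ (T.away a p).image (fun c => (a, c)) →
        (w, b) = (p, a) ∨ (w, b) ∈ Lo ∨ (w, b) ∈ Hi := by
    intro w b hwb
    rw [Finset.mem_insert, Finset.mem_sdiff] at hwb
    tauto
  have htop' : ∀ p' a', a' ∈ S → a' ≠ a → IsTop T R g S Lo Hi p' a' →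
      IsTop T R g (S.erase a) (insert (p, a) Lo) (Hi \ (T.away a p).image fun c => (a, c)) p' a' := by
    intro p' a' ha' hne ht
    refine ⟨fun s hs => ht.1 s (Finset.mem_of_mem_erase hs), fun c hc => ?_⟩
    obtain ⟨h1, h2⟩ := ht.2 c hc
    refine ⟨?_, fun w b hwb hw => ?_⟩
    · rw [Finset.mem_sdiff, Finset.mem_image]
      refine ⟨h1, ?_⟩
      rintro ⟨x, -, hx⟩
      exact hne (Prod.ext_iff.1 hx).1.symm
    · rcases hnew w b hwb with h3 | h3
      · obtain ⟨rfl, rfl⟩ := Prod.ext_iff.1 h3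
        exact h.le_hi a' c h1 _ hp _ ha hpa
      · exact h2 w b h3 hw
  refine ⟨?_, fun v hv => h.two_le v (Finset.mem_of_mem_erase hv), ?_, ?_, ?_, ?_, ?_, ?_⟩
  · intro v hv w hw x hvx hd
    obtain ⟨hva, hvS⟩ := Finset.mem_erase.1 hv
    obtain ⟨hwa, hwS⟩ := Finset.mem_erase.1 hw
    refine Finset.mem_erase.2 ⟨?_, h.step_mem v hvS w hwS x hvx hd⟩
    rintro rfl
    -- A path through `a` between two other vertices of `S` would have to enter and leave `a`
    -- through its only inner neighbour `p`.
    have hvp := h.eq_of_isTop hT hpa htop hvS hvx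
    obtain ⟨q, hq, hqd⟩ := hT.exists_adj_dist hwa.symm
    have hqp := h.eq_of_isTop hT hpa htop (h.step_mem x ha w hwS q hq hqd) hq.symm
    rw [hqp, ← hvp] at hqd
    omega
  · intro v x
    constructor
    · intro hvx
      rw [Finset.mem_insert, Finset.mem_sdiff, Finset.mem_image] at hvx
      have key : (v, x) ∈ Lo ∨ (v, x) ∈ Hi → v ≠ a → v ∈ S.erase a ∧ x ∉ S.erase a ∧ T.Adj v x :=
        fun h1 h2 => by
          obtain ⟨h3, h4, h5⟩ := (h.mem_or v x).1 h1
          exact ⟨Finset.mem_erase.2 ⟨h2, h3⟩, fun h6 => h4 (Finset.mem_of_mem_erase h6), h5⟩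
      rcases hvx with (hvx | hvx) | ⟨hvx, hvx'⟩
      · obtain ⟨rfl, rfl⟩ := Prod.ext_iff.1 hvx
        exact ⟨Finset.mem_erase.2 ⟨hpa.ne, hp⟩, Finset.notMem_erase _ _, hpa⟩
      · refine key (Or.inl hvx) ?_
        rintro rfl
        obtain ⟨-, h4, h5⟩ := (h.mem_or v x).1 (Or.inl hvx)
        exact Finset.disjoint_left.1 h.disj hvx (htop.2 x (hchild x h4 h5)).1
      · refine key (Or.inr hvx) ?_
        rintro rfl
        obtain ⟨-, h4, h5⟩ := (h.mem_or v x).1 (Or.inr hvx)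
        exact hvx' ⟨x, hchild x h4 h5, rfl⟩
    · rintro ⟨hv, hx, hvx⟩
      obtain ⟨hva, hvS⟩ := Finset.mem_erase.1 hv
      rw [Finset.mem_insert, Finset.mem_sdiff, Finset.mem_image]
      by_cases hxa : x = a
      · subst hxa
        left; left
        rw [h.eq_of_isTop hT hpa htop hvS hvx]
      · have hxS : x ∉ S := fun h' => hx (Finset.mem_erase.2 ⟨hxa, h'⟩)
        rcases (h.mem_or v x).2 ⟨hvS, hxS, hvx⟩ with h1 | h1
        · exact Or.inl (Or.inr h1)
        · refine Or.inr ⟨h1, ?_⟩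
          rintro ⟨c, -, hc⟩
          exact hva (Prod.ext_iff.1 hc).1.symm
  · rw [Finset.disjoint_left]
    intro e he he'
    rw [Finset.mem_insert] at he
    have he' := (Finset.mem_sdiff.1 he').1
    rcases he with rfl | he
    · exact ((h.mem_or p a).1 (Or.inr he')).2.1 ha
    · exact Finset.disjoint_left.1 h.disj he he'
  · intro v x hvx p' hp' a' ha' hpa'
    have hp'S := Finset.mem_of_mem_erase hp'
    have ha'S := Finset.mem_of_mem_erase ha'
    rcases Finset.mem_insert.1 hvx with hvx | hvx
    · obtain ⟨rfl, rfl⟩ := Prod.ext_iff.1 hvx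
      exact h.value_le_of_isTop hE hpa htop hp'S ha'S hpa'
    · exact h.lo_le v x hvx p' hp'S a' ha'S hpa'
  · intro v x hvx p' hp' a' ha' hpa'
    exact h.le_hi v x (Finset.mem_sdiff.1 hvx).1 p' (Finset.mem_of_mem_erase hp') a'
      (Finset.mem_of_mem_erase ha') hpa'
  · intro p' hp' a' ha' hpa' v x hvx hle
    have hp'S := Finset.mem_of_mem_erase hp'
    obtain ⟨hne, ha'S⟩ := Finset.mem_erase.1 ha'
    refine htop' p' a' ha'S hne ?_
    rcases Finset.mem_insert.1 hvx with hvx | hvx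
    · obtain ⟨rfl, rfl⟩ := Prod.ext_iff.1 hvx
      -- Inner edges tied with the new low tip are tops already by `htie`.
      exact htie p' hp'S a' ha'S hpa' hle
    · exact h.tie_lo p' hp'S a' ha'S hpa' v x hvx hle
  · intro p' hp' a' ha' hpa' v x hvx hle
    have ht := h.tie_hi p' (Finset.mem_of_mem_erase hp') a' (Finset.mem_of_mem_erase ha') hpa' v x
      (Finset.mem_sdiff.1 hvx).1 hle
    refine ⟨fun s hs => ht.1 s (Finset.mem_of_mem_erase hs), fun c hc => ?_⟩
    obtain ⟨h1, h2⟩ := ht.2 c hc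
    refine ⟨Finset.mem_insert_of_mem h1, fun w b hwb hw => ?_⟩
    rcases hnew w b hwb.symm with h3 | h3
    · obtain ⟨rfl, rfl⟩ := Prod.ext_iff.1 h3
      exact neg_le_neg (h.lo_le a' c h1 _ hp _ ha hpa)
    · exact h2 w b h3.symm hw

/-- If no edge inside `S` has the value of a high tip, some vertex at a high tip of maximal value
dominates all other vertices of `S`. -/
lemma exists_dominant (h : ContractionState T R g S Lo Hi) (hE : ExchangeSystem T R g)
    (hstrict : ∀ v x, (v, x) ∈ Hi → ∀ p ∈ S, ∀ a ∈ S, T.Adj p a → R p a < R v x)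
    (hne : Hi.Nonempty) : ∃ a ∈ S, ∀ w ∈ S, w ≠ a → g w ≤ g a ∧
      ∀ c ∈ T.away a w, ∀ b ∈ T.away w a, R w b ≤ R a c := by
  classical
  have hT := hE.tree
  obtain ⟨⟨a₁, c₁⟩, h₁, hmax⟩ := Hi.exists_max_image (fun e => R e.1 e.2) hne
  simp only [Prod.forall] at hmax
  let m := R a₁ c₁
  let count : V → ℕ := fun v => ((T.away v v).filter fun c => R v c = m).card
  let A := S.filter fun v => ∃ c, (v, c) ∈ Hi ∧ R v c = m
  have hA : A.Nonempty :=
    ⟨a₁, Finset.mem_filter.2 ⟨((h.mem_or a₁ c₁).1 (Or.inr h₁)).1, c₁, h₁, rfl⟩⟩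
  -- Ties in `g` are broken by the number of outgoing edges of value `m`, to settle the case where
  -- the exchange property points from `a` to `w`.
  obtain ⟨a, haA, hamax⟩ := A.exists_max_image (fun v => toLex (g v, count v)) hA
  obtain ⟨haS, c₀, hc₀, hc₀m⟩ := Finset.mem_filter.1 haA
  refine ⟨a, haS, fun w hw hwa => ?_⟩
  rcases hE.exchange a w hwa.symm with h' | ⟨hg, hle⟩
  · exact h'
  obtain ⟨-, hc₀S, hac₀⟩ := (h.mem_or a c₀).1 (Or.inr hc₀)
  have hc₀w := h.mem_away_of_tip hT haS hc₀S hac₀ hw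
  obtain ⟨q, hq, hqd, -, hqaway⟩ := hT.exists_step hwa.symm
  have hqS := h.step_mem a haS w hw q hq hqd
  have hqm : R a q < m := hstrict a₁ c₁ h₁ a haS q hqS hq
  -- In the unfavourable alternative every edge at `w` away from `a` has value at least `m`. By
  -- strictness it cannot be inner or low, so it is a high tip of value exactly `m`.
  have hb : ∀ b ∈ T.away w a, (w, b) ∈ Hi ∧ R w b = m := by
    intro b hb
    have h1 : m ≤ R w b := hc₀m ▸ hle c₀ hc₀w b hb
    have hwb := (mem_away.1 hb).1
    have hbS : b ∉ S := fun hbS => by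
      have : R w b < m := hstrict a₁ c₁ h₁ w hw b hbS hwb
      linarith
    rcases (h.mem_or w b).2 ⟨hw, hbS, hwb⟩ with h2 | h2
    · have := h.lo_le w b h2 a haS q hqS hq
      linarith
    · exact ⟨h2, le_antisymm (hmax w b h2) h1⟩
  have hcw := hT.card_away_add_one hwa
  have hca := hT.card_away_add_one hwa.symm
  have h2w := h.two_le w hw
  obtain ⟨b₀, hb₀⟩ := Finset.card_pos.1 (show 0 < (T.away w a).card by omega)
  have hwA : w ∈ A := Finset.mem_filter.2 ⟨hw, b₀, hb b₀ hb₀⟩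
  have hlex := hamax w hwA
  simp only [Prod.Lex.toLex_le_toLex] at hlex
  rcases hlex with hlex | ⟨hgeq, hcount⟩
  · exact absurd hlex (not_lt.2 hg)
  have hdeg := hE.card_eq w a hgeq
  have hsubw : T.away w a ⊆ (T.away w w).filter fun c => R w c = m := by
    intro b hb'
    exact Finset.mem_filter.2 ⟨mem_away_self.2 (mem_away.1 hb').1, (hb b hb').2⟩
  have hsuba : ((T.away a a).filter fun c => R a c = m) ⊆ T.away a w := by
    intro c hc
    obtain ⟨hc1, hc2⟩ := Finset.mem_filter.1 hc
    refine (hqaway c).2 ⟨mem_away_self.1 hc1, ?_⟩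
    rintro rfl
    exact hqm.ne hc2
  have hcc := Finset.card_le_card hsubw
  -- Of the edges at `w`, all but at most one have value `m`, whereas at `a` the inner edge towards
  -- `w` does not. Maximality of the count makes all the other edges at `a` have value `m` too.
  have heq := Finset.eq_of_subset_of_card_le hsuba (by
    have : ((T.away w w).filter fun c => R w c = m).card ≤
      ((T.away a a).filter fun c => R a c = m).card := hcount
    omega)
  refine ⟨hgeq.le, fun c hc b hb' => ?_⟩
  rw [(hb b hb').2]
  rw [← heq] at hc
  exact (Finset.mem_filter.1 hc).2.ge

/-- A vertex of `S` farthest from a given one is an end of `S`, and its degree exceeds the number of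
low tips by at least 2, so one of its tips is high. A dominant vertex `a` has values at least as
large on all edges away from that end, which makes them high tips. -/
lemma exists_isTop (h : ContractionState T R g S Lo Hi) (hE : ExchangeSystem T R g)
    (hstrict : ∀ v x, (v, x) ∈ Hi → ∀ p ∈ S, ∀ a ∈ S, T.Adj p a → R p a < R v x)
    (hcount : ∀ s ∈ S, Lo.card + 2 ≤ (T.away s s).card) (hS : 1 < S.card) :
    ∃ p ∈ S, ∃ a ∈ S, T.Adj p a ∧ IsTop T R g S Lo Hi p a := by
  classical
  have hT := hE.tree
  have far : ∀ r ∈ S, ∃ u ∈ S, u ≠ r ∧ ∃ b ∈ T.away u r, (u, b) ∈ Hi := by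
    intro r hr
    obtain ⟨u, hu, humax⟩ := S.exists_max_image (fun u => T.dist u r) ⟨r, hr⟩
    have hur : u ≠ r := by
      rintro rfl
      obtain ⟨w, hw, hwr⟩ := Finset.exists_mem_ne hS u
      have h1 := humax w hw
      have h2 := hT.connected.pos_dist_of_ne hwr
      rw [dist_self] at h1
      omega
    have hout : ∀ b ∈ T.away u r, (u, b) ∈ Lo ∨ (u, b) ∈ Hi := by
      intro b hb
      refine (h.mem_or u b).2 ⟨hu, fun hbS => ?_, (mem_away.1 hb).1⟩
      have h1 := humax b hbS
      have h2 := (mem_away.1 hb).2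
      omega
    by_contra hcon
    push Not at hcon
    have hsub : (T.away u r).image (fun b => (u, b)) ⊆ Lo := by
      intro e he
      obtain ⟨b, hb, rfl⟩ := Finset.mem_image.1 he
      exact (hout b hb).resolve_right (hcon u hu hur b hb)
    have h1 := Finset.card_le_card hsub
    rw [Finset.card_image_of_injective _ (Prod.mk_right_injective u)] at h1
    have h2 := hT.card_away_add_one hur
    have h3 := hcount u hu
    omega
  obtain ⟨r, hr⟩ := Finset.card_pos.1 (show 0 < S.card by omega)
  obtain ⟨u₀, -, -, b₀, -, hb₀⟩ := far r hr
  obtain ⟨a, ha, hdom⟩ := h.exists_dominant hE hstrict ⟨_, hb₀⟩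
  obtain ⟨u, hu, hua, b, hb, hbHi⟩ := far a ha
  obtain ⟨p, hp, hpd, -, hpaway⟩ := hT.exists_step hua.symm
  have hpS := h.step_mem a ha u hu p hp hpd
  refine ⟨p, hpS, a, ha, hp.symm, fun s hs => ?_, fun c hc => ?_⟩
  · by_cases hsa : s = a
    · rw [hsa]
    · exact (hdom s hs hsa).1
  · have hc' := (mem_away_of_adj hT hp).1 hc
    have hle := (hdom u hu hua).2 c ((hpaway c).2 hc') b hb
    have hcS : c ∉ S := fun hcS => by
      have := hstrict u b hbHi a ha c hcS hc'.1
      linarith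
    refine ⟨?_, fun w b' hwb hwa => ?_⟩
    · rcases (h.mem_or a c).2 ⟨ha, hcS, hc'.1⟩ with h1 | h1
      · have h2 := h.lo_le a c h1 a ha p hpS hp
        have h3 := hstrict u b hbHi a ha p hpS hp
        linarith
      · exact h1
    · obtain ⟨hw, hb'S, hwb'⟩ := (h.mem_or w b').1 hwb
      exact (hdom w hw hwa).2 c (h.mem_away_of_tip hT ha hcS hc'.1 hw) b'
        (h.mem_away_of_tip hT hw hb'S hwb' ha)

/-- A vertex dominant in the dual sense has minimal degree, less than the number of low tips plus 2.
A neighbour `c` other than `p` that is not a low tip would leave too little room at `a` for all low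
tips, and a low tip elsewhere would contradict dominance. -/
lemma exists_isBottom (h : ContractionState T R g S Lo Hi) (hE : ExchangeSystem T R g)
    (hg : ∀ v w, g v ≤ g w → (T.away v v).card ≤ (T.away w w).card)
    (hstrict : ∀ v x, (v, x) ∈ Lo → ∀ p ∈ S, ∀ a ∈ S, T.Adj p a → R v x < R p a)
    {s₀ : V} (hs₀ : s₀ ∈ S) (hcount : (T.away s₀ s₀).card < Lo.card + 2) (hS : 1 < S.card) :
    ∃ p ∈ S, ∃ a ∈ S, T.Adj p a ∧ IsTop T (-R) (-g) S Hi Lo p a := by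
  classical
  have hT := hE.tree
  have hLo : Lo.Nonempty := Finset.card_pos.1 (by have := h.two_le s₀ hs₀; omega)
  obtain ⟨a, ha, hdom⟩ := h.dual.exists_dominant hE.dual
    (fun v x hx p hp a ha hpa => neg_lt_neg (hstrict v x hx p hp a ha hpa)) hLo
  simp only [Pi.neg_apply, neg_le_neg_iff] at hdom
  have hmin : ∀ s ∈ S, g a ≤ g s := by
    intro s hs
    by_cases hsa : s = a
    · rw [hsa]
    · exact (hdom s hs hsa).1
  obtain ⟨w₀, hw₀, hw₀a⟩ := Finset.exists_mem_ne hS a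
  obtain ⟨p, hp, hpd, -, -⟩ := hT.exists_step hw₀a.symm
  have hpS := h.step_mem a ha w₀ hw₀ p hp hpd
  have hda := hg a s₀ (hmin s₀ hs₀)
  refine ⟨p, hpS, a, ha, hp.symm, fun s hs => neg_le_neg (hmin s hs), fun c hc => ?_⟩
  obtain ⟨hac, hcp⟩ := (mem_away_of_adj hT hp).1 hc
  have hcLo : (a, c) ∈ Lo := by
    by_contra hcLo
    obtain ⟨w, y, hwy, hwa⟩ : ∃ w y, (w, y) ∈ Lo ∧ w ≠ a := by
      by_contra hcon
      push Not at hcon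
      have hsub : Lo ⊆ (((T.away a a).erase p).erase c).image fun b => (a, b) := by
        rintro ⟨w, y⟩ hwy
        obtain rfl := hcon w y hwy
        obtain ⟨-, hy, hay⟩ := (h.mem_or w y).1 (Or.inl hwy)
        refine Finset.mem_image.2 ⟨y, ?_, rfl⟩
        refine Finset.mem_erase.2 ⟨?_, Finset.mem_erase.2 ⟨?_, mem_away_self.2 hay⟩⟩
        · rintro rfl; exact hcLo hwy
        · rintro rfl; exact hy hpS
      have h1 := Finset.card_le_card hsub
      rw [Finset.card_image_of_injective _ (Prod.mk_right_injective a),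
        Finset.card_erase_of_mem (Finset.mem_erase.2 ⟨hcp, mem_away_self.2 hac⟩),
        Finset.card_erase_of_mem (mem_away_self.2 hp)] at h1
      have := h.two_le a ha
      omega
    obtain ⟨hw, hy, hwy'⟩ := (h.mem_or w y).1 (Or.inl hwy)
    have hyaway := h.mem_away_of_tip hT hw hy hwy' ha
    by_cases hcS : c ∈ S
    -- At most one of the two neighbours `c` and `p` lies towards `w`; the other gives an inner edge
    -- that dominance puts at or below a low tip.
    · have key : c ∈ T.away a w ∨ p ∈ T.away a w := by
        by_contra hcon
        push Not at hcon
        have h1 := (hT.away_or hac w).resolve_left hcon.1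
        have h2 := (hT.away_or hp w).resolve_left hcon.2
        exact hcp (hT.eq_of_adj_of_dist hac hp h1 h2)
      rcases key with h1 | h1
      · have h2 := (hdom w hw hwa).2 c h1 y hyaway
        have h3 := hstrict w y hwy a ha c hcS hac
        linarith
      · have h2 := (hdom w hw hwa).2 p h1 y hyaway
        have h3 := hstrict w y hwy a ha p hpS hp
        linarith
    · have h1 := ((h.mem_or a c).2 ⟨ha, hcS, hac⟩).resolve_left hcLo
      have h2 := (hdom w hw hwa).2 c (h.mem_away_of_tip hT ha hcS hac hw) y hyaway
      have h3 := hstrict w y hwy a ha p hpS hp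
      have h4 := h.le_hi a c h1 a ha p hpS hp
      linarith
  have hcS := ((h.mem_or a c).1 (Or.inl hcLo)).2.1
  refine ⟨hcLo, fun w b hwb hwa => ?_⟩
  obtain ⟨hw, hbS, hwb'⟩ := (h.mem_or w b).1 hwb.symm
  exact neg_le_neg ((hdom w hw hwa).2 c (h.mem_away_of_tip hT ha hcS hac hw) b
    (h.mem_away_of_tip hT hw hbS hwb' ha))

open Classical in
/-- Unless `S` is a single vertex, some vertex can be contracted to a low or to a high tip. -/
theorem exists_contraction (h : ContractionState T R g S Lo Hi) (hE : ExchangeSystem T R g)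
    (hg : ∀ v w, g v ≤ g w → (T.away v v).card ≤ (T.away w w).card) (hS : 1 < S.card) :
    ∃ p ∈ S, ∃ a ∈ S, T.Adj p a ∧
      ((IsTop T R g S Lo Hi p a ∧ ContractionState T R g (S.erase a) (insert (p, a) Lo)
          (Hi \ (T.away a p).image fun c => (a, c))) ∨
        (IsTop T (-R) (-g) S Hi Lo p a ∧ ContractionState T R g (S.erase a)
          (Lo \ (T.away a p).image fun c => (a, c)) (insert (p, a) Hi))) := by
  have undual : ∀ {S : Finset V} {Lo Hi : Finset (V × V)},
      ContractionState T (-R) (-g) S Hi Lo → ContractionState T R g S Lo Hi := fun h => by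
    have := h.dual
    rwa [neg_neg, neg_neg] at this
  -- Ties are resolved first: an inner edge tied with a tip can be contracted at once. In the
  -- remaining case all inner values lie strictly between low and high tips, and a count decides the
  -- direction.
  by_cases hlo : ∃ p ∈ S, ∃ a ∈ S, T.Adj p a ∧ ∃ v x, (v, x) ∈ Lo ∧ R p a ≤ R v x
  · obtain ⟨p, hp, a, ha, hpa, v, x, hvx, hle⟩ := hlo
    have htop := h.tie_lo p hp a ha hpa v x hvx hle
    exact ⟨p, hp, a, ha, hpa, Or.inl ⟨htop, h.contract hE hp ha hpa htop
      fun p' hp' a' ha' hpa' hle' => h.tie_lo p' hp' a' ha' hpa' v x hvx (hle'.trans hle)⟩⟩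
  by_cases hhi : ∃ p ∈ S, ∃ a ∈ S, T.Adj p a ∧ ∃ v x, (v, x) ∈ Hi ∧ R v x ≤ R p a
  · obtain ⟨p, hp, a, ha, hpa, v, x, hvx, hle⟩ := hhi
    have htop := h.tie_hi p hp a ha hpa v x hvx hle
    exact ⟨p, hp, a, ha, hpa, Or.inr ⟨htop, undual (h.dual.contract hE.dual hp ha hpa htop
      fun p' hp' a' ha' hpa' hle' => h.tie_hi p' hp' a' ha' hpa' v x hvx
        (hle.trans (neg_le_neg_iff.1 hle')))⟩⟩
  push Not at hlo hhi
  by_cases hcount : ∀ s ∈ S, Lo.card + 2 ≤ (T.away s s).card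
  · have hstrict : ∀ v x, (v, x) ∈ Hi → ∀ p ∈ S, ∀ a ∈ S, T.Adj p a → R p a < R v x :=
      fun v x hx p hp a ha hpa => hhi p hp a ha hpa v x hx
    obtain ⟨p, hp, a, ha, hpa, htop⟩ := h.exists_isTop hE hstrict hcount hS
    exact ⟨p, hp, a, ha, hpa, Or.inl ⟨htop, h.contract hE hp ha hpa htop
      fun p' hp' a' ha' hpa' hle' =>
        h.isTop_of_le hE hstrict hp ha hpa htop hp' ha' hpa' hle'⟩⟩
  · push Not at hcount
    obtain ⟨s₀, hs₀, hcount⟩ := hcount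
    have hstrict : ∀ v x, (v, x) ∈ Lo → ∀ p ∈ S, ∀ a ∈ S, T.Adj p a → R v x < R p a :=
      fun v x hx p hp a ha hpa => hlo p hp a ha hpa v x hx
    obtain ⟨p, hp, a, ha, hpa, htop⟩ := h.exists_isBottom hE hg hstrict hs₀ hcount hS
    exact ⟨p, hp, a, ha, hpa, Or.inr ⟨htop, undual (h.dual.contract hE.dual hp ha hpa htop
      fun p' hp' a' ha' hpa' hle' => h.dual.isTop_of_le hE.dual
        (fun v x hx p hp a ha hpa => neg_lt_neg (hstrict v x hx p hp a ha hpa))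
        hp ha hpa htop hp' ha' hpa' hle')⟩⟩

end ContractionState

end SimpleGraph

/-! ### Exchange-extremal trees are assembled from their leaves -/

namespace SimpleGraph

variable {V : Type*} [Fintype V] {T : SimpleGraph V} {ρ : RTree → ℝ} {f : Multiset ℝ → ℝ}

lemma IsTree.exchangeSystem (hT : T.IsTree) (hρ : IsAlternatingInvariant ρ f)
    (hext : ExchangeExtremal ρ T) :
    ExchangeSystem T (branchValue ρ T) fun v => ((T.away v v).card : ℤ) where
  tree := hT
  exchange v w hvw := by
    have h1 := hT.card_away_add_one hvw
    have h2 := hT.card_away_add_one hvw.symm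
    refine (hT.exchange hρ hext hvw).imp (fun h => ⟨?_, h.2⟩) (fun h => ⟨?_, h.2⟩)
    · have := h.1
      omega
    · have := h.1
      omega
  mono p x q y hpx hqy hg hle := by
    have h1 := hT.card_away_add_one hpx.ne'
    have h2 := hT.card_away_add_one hqy.ne'
    obtain ⟨h3, h4⟩ := hT.branchValue_le hρ (p := p) (x := x) (q := q) (y := y) (by omega) hle
    refine ⟨h3, fun h => ⟨?_, (h4 h).2⟩⟩
    have := (h4 h).1
    omega
  card_eq v w h := by exact_mod_cast h

lemma IsTree.branchValue_congr (hT : T.IsTree) (hρ : IsAlternatingInvariant ρ f) {w w' v : V}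
    (h : T.away v w = T.away v w') : branchValue ρ T w v = branchValue ρ T w' v := by
  obtain ⟨t, ht⟩ := hT.exists_isBranch w v
  rw [← ht.value_eq hρ, ← (ht.congr h).value_eq hρ]

/-- Tips with the same value are represented by the same rooted trees. -/
lemma ContractionState.isBranch_of_value_eq {R : V → V → ℝ} {g : V → ℤ} {S : Finset V}
    {Lo Hi : Finset (V × V)} (h : ContractionState T R g S Lo Hi) (hT : T.IsTree)
    (hρ : IsAlternatingInvariant ρ f) (hext : ExchangeExtremal ρ T) {v x w y : V}
    (hv : v ∈ S) (hx : x ∉ S) (hvx : T.Adj v x) (hw : w ∈ S) (hy : y ∉ S) (hwy : T.Adj w y)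
    (heq : branchValue ρ T v x = branchValue ρ T w y) {t : RTree} (ht : IsBranch T v x t) :
    IsBranch T w y t := by
  have key : x ≠ y → T.away x y = T.away x v → T.away y x = T.away y w → IsBranch T w y t := by
    intro hxy h1 h2
    refine (IsBranch.transfer hT hρ hext t hxy (ht.congr h1.symm) ?_).congr h2
    rw [hT.branchValue_congr hρ h1, hT.branchValue_congr hρ h2, heq]
  by_cases hvw : v = w
  · subst hvw
    by_cases hxy : x = y
    · subst hxy; exact ht
    · exact key hxy (hT.away_siblings hvx hwy hxy) (hT.away_siblings hwy hvx (Ne.symm hxy))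
  · obtain ⟨h1, h2, h3⟩ := hT.away_pair hvw (h.mem_away_of_tip hT hv hx hvx hw)
      (h.mem_away_of_tip hT hw hy hwy hv)
    exact key h1 h2 h3

open Classical in
/-- The tips at a vertex `a` whose values are maximal can be taken to be represented by the last
trees of a sorted list, and they form the branch at `a`. -/
lemma exists_split_at {r : V × V → ℝ} {Q : List (V × V)} {ts : List RTree} (hnd : Q.Nodup)
    (hsorted : Q.Pairwise fun e e' => r e ≤ r e')
    (hb : List.Forall₂ (fun e t => IsBranch T e.1 e.2 t) Q ts)
    (htr : ∀ e ∈ Q, ∀ e' ∈ Q, r e = r e' → ∀ t, IsBranch T e.1 e.2 t → IsBranch T e'.1 e'.2 t)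
    {p a : V} (hmem : ∀ c, (a, c) ∈ Q ↔ c ∈ T.away a p)
    (hle : ∀ c ∈ T.away a p, ∀ e ∈ Q, e.1 ≠ a → r e ≤ r (a, c)) :
    ∃ (Q' : List (V × V)) (ts' b : List RTree), ts = ts' ++ b ∧
      List.Forall₂ (fun e t => IsBranch T e.1 e.2 t) Q' ts' ∧ Q'.Nodup ∧
      (Q'.Pairwise fun e e' => r e ≤ r e') ∧
      Q'.toFinset = Q.toFinset \ (T.away a p).image (fun c => (a, c)) ∧
      b.length = (T.away a p).card ∧ IsBranch T p a (node b) := by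
  set Q' := Q.filter fun e => e.1 ≠ a with hQ'
  set K := Q.filter fun e => !(decide (e.1 ≠ a)) with hK
  have hperm : (Q' ++ K).Perm Q := List.filter_append_perm (fun e : V × V => decide (e.1 ≠ a)) Q
  have hKmem : ∀ e, e ∈ K ↔ e ∈ Q ∧ e.1 = a := by
    intro e; rw [hK, List.mem_filter]; simp
  have hQ'mem : ∀ e, e ∈ Q' ↔ e ∈ Q ∧ e.1 ≠ a := by
    intro e; rw [hQ', List.mem_filter]; simp
  have hs : (Q' ++ K).Pairwise fun e e' => r e ≤ r e' := by
    rw [List.pairwise_append]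
    refine ⟨hsorted.filter _, hsorted.filter _, ?_⟩
    rintro e he ⟨a', c⟩ he'
    obtain ⟨h1, h2⟩ := (hKmem _).1 he'
    obtain rfl : a' = a := h2
    obtain ⟨h3, h4⟩ := (hQ'mem _).1 he
    exact hle c ((hmem c).1 h1) e h3 h4
  -- The tips at `a` need not come last in `Q`, only be tied with those that do. Two sorted
  -- arrangements have the same sequence of values, so position by position the trees in `ts` still
  -- represent the rearranged tips.
  have hmap : (Q' ++ K).map r = Q.map r :=
    (hperm.map r).eq_of_pairwise' (r := (· ≤ ·)) (List.pairwise_map.2 hs)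
      (List.pairwise_map.2 hsorted)
  have hb' : List.Forall₂ (fun e t => IsBranch T e.1 e.2 t) (Q' ++ K) ts := by
    rw [List.forall₂_iff_get] at hb ⊢
    refine ⟨hperm.length_eq.trans hb.1, fun i hi hi' => ?_⟩
    have hiQ : i < Q.length := hb.1 ▸ hi'
    have h1 : r Q[i] = r (Q' ++ K)[i] := by
      have := List.getElem_of_eq hmap.symm (i := i) (by simpa using hiQ)
      simpa only [List.getElem_map] using this
    exact htr _ (List.getElem_mem _) _ (hperm.mem_iff.1 (List.getElem_mem _)) h1 _
      (hb.2 i hiQ hi')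
  have hlen := hb'.length_eq
  refine ⟨Q', ts.take Q'.length, ts.drop Q'.length, (List.take_append_drop _ _).symm, ?_,
    hnd.filter _, hsorted.filter _, ?_, ?_, ?_⟩
  · have := List.forall₂_take Q'.length hb'
    rwa [List.take_left] at this
  · ext ⟨w, b⟩
    rw [List.mem_toFinset, hQ'mem, Finset.mem_sdiff, List.mem_toFinset, Finset.mem_image]
    refine and_congr_right fun hwb => not_congr ⟨fun hwa => ?_, ?_⟩
    · obtain rfl : w = a := hwa
      exact ⟨b, (hmem b).1 hwb, rfl⟩
    · rintro ⟨c, -, hc⟩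
      exact (Prod.ext_iff.1 hc).1.symm
  all_goals
    have hdrop := List.forall₂_drop Q'.length hb'
    rw [List.drop_left] at hdrop
    have hKnd : (K.map Prod.snd).Nodup := by
      refine List.Nodup.map_on ?_ (hnd.filter _)
      rintro ⟨x1, x2⟩ hx ⟨y1, y2⟩ hy hxy
      have h1 := ((hKmem _).1 hx).2
      have h2 := ((hKmem _).1 hy).2
      exact Prod.ext (h1.trans h2.symm) hxy
    have hKm : ∀ x, x ∈ K.map Prod.snd ↔ x ∈ T.away a p := by
      intro x
      rw [List.mem_map, ← hmem]
      constructor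
      · rintro ⟨⟨w, b⟩, hwb, rfl⟩
        obtain ⟨h1, h2⟩ := (hKmem _).1 hwb
        obtain rfl : w = a := h2
        exact h1
      · intro hx
        exact ⟨(a, x), (hKmem _).2 ⟨hx, rfl⟩, rfl⟩
  · rw [← hdrop.length_eq, ← length_eq_card_away hKnd hKm, List.length_map]
  · refine isBranch_node.2 ⟨_, hKnd, hKm, List.forall₂_map_left_iff.2 ?_⟩
    refine List.forall₂_iff_get.2 ⟨hdrop.length_eq, fun i hi hi' => ?_⟩
    have h1 := (List.forall₂_iff_get.1 hdrop).2 i hi hi'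
    have h2 := ((hKmem _).1 (List.getElem_mem hi)).2
    rw [← h2]
    exact h1

/-! ### From contractions to an assembly. -/

/-- The degrees of the vertices in `S`, in non-decreasing order. -/
noncomputable def degreeList (T : SimpleGraph V) (S : Finset V) : List ℕ :=
  (S.val.map fun v => (T.away v v).card).sort (· ≤ ·)

open Classical in
lemma degreeList_perm {S : Finset V} {a : V} (ha : a ∈ S) :
    (degreeList T S).Perm ((T.away a a).card :: degreeList T (S.erase a)) := by
  rw [← Multiset.coe_eq_coe, degreeList, Multiset.sort_eq, ← Multiset.cons_coe, degreeList,
    Multiset.sort_eq, ← Multiset.map_cons (fun v => (T.away v v).card), Finset.erase_val,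
    Multiset.cons_erase ha]

lemma mem_degreeList {S : Finset V} {d : ℕ} :
    d ∈ degreeList T S ↔ ∃ v ∈ S, (T.away v v).card = d := by
  simp [degreeList]

open Classical in
lemma degreeList_of_max {S : Finset V} {a : V} (ha : a ∈ S)
    (hmax : ∀ s ∈ S, (T.away s s).card ≤ (T.away a a).card) :
    degreeList T S = degreeList T (S.erase a) ++ [(T.away a a).card] := by
  refine ((degreeList_perm ha).trans (List.perm_append_singleton _ _).symm).eq_of_pairwise'
    (r := (· ≤ ·)) (Multiset.pairwise_sort _ _) ?_
  rw [List.pairwise_append]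
  refine ⟨Multiset.pairwise_sort _ _, by simp, fun x hx y hy => ?_⟩
  obtain ⟨v, hv, rfl⟩ := mem_degreeList.1 hx
  rw [List.mem_singleton.1 hy]
  exact hmax v (Finset.mem_of_mem_erase hv)

open Classical in
lemma degreeList_of_min {S : Finset V} {a : V} (ha : a ∈ S)
    (hmin : ∀ s ∈ S, (T.away a a).card ≤ (T.away s s).card) :
    degreeList T S = (T.away a a).card :: degreeList T (S.erase a) := by
  refine (degreeList_perm ha).eq_of_pairwise'
    (r := (· ≤ ·)) (Multiset.pairwise_sort _ _) ?_
  rw [List.pairwise_cons]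
  refine ⟨fun x hx => ?_, Multiset.pairwise_sort _ _⟩
  obtain ⟨v, hv, rfl⟩ := mem_degreeList.1 hx
  exact hmin v (Finset.mem_of_mem_erase hv)

-- Each contraction of `S` is one step of `Assembles`. The tips are sorted so that those consumed
-- next stand at the end of their list and a new one belongs at its head: low tips decrease, high
-- tips increase.
open Classical in
theorem ContractionState.assembles (hT : T.IsTree) (hρ : IsAlternatingInvariant ρ f)
    (hext : ExchangeExtremal ρ T) {S : Finset V} (hS : S.Nonempty) {L H : List (V × V)}
    {tL tH : List RTree}
    (h : ContractionState T (branchValue ρ T) (fun v => ((T.away v v).card : ℤ)) S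
      L.toFinset H.toFinset) (hLn : L.Nodup) (hHn : H.Nodup)
    (hL : L.Pairwise fun e e' => branchValue ρ T e'.1 e'.2 ≤ branchValue ρ T e.1 e.2)
    (hH : H.Pairwise fun e e' => branchValue ρ T e.1 e.2 ≤ branchValue ρ T e'.1 e'.2)
    (htL : List.Forall₂ (fun e t => IsBranch T e.1 e.2 t) L tL)
    (htH : List.Forall₂ (fun e t => IsBranch T e.1 e.2 t) H tH) :
    ∃ F v, Assembles (degreeList T S) tL tH F ∧ IsBranch T v v F := by
  induction hn : S.card generalizing S L H tL tH with
  | zero => exact absurd (Finset.card_eq_zero.1 hn) hS.ne_empty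
  | succ n ih =>
  by_cases hS1 : S.card = 1
  · obtain ⟨r, rfl⟩ := Finset.card_eq_one.1 hS1
    have hmem : ∀ v x, (v, x) ∈ L ++ H ↔ v = r ∧ T.Adj r x := by
      intro v x
      have := h.mem_or v x
      rw [List.mem_toFinset, List.mem_toFinset] at this
      rw [List.mem_append, this, Finset.mem_singleton, Finset.mem_singleton]
      constructor
      · rintro ⟨rfl, -, h1⟩; exact ⟨rfl, h1⟩
      · rintro ⟨rfl, h1⟩; exact ⟨rfl, h1.ne', h1⟩
    have hnd : (L ++ H).Nodup := List.nodup_append.2 ⟨hLn, hHn, by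
      rintro e he e' he' rfl
      exact Finset.disjoint_left.1 h.disj (List.mem_toFinset.2 he) (List.mem_toFinset.2 he')⟩
    have hbranch := List.rel_append htL htH
    have hnd' : ((L ++ H).map Prod.snd).Nodup := by
      refine List.Nodup.map_on ?_ hnd
      rintro ⟨x1, x2⟩ hx ⟨y1, y2⟩ hy hxy
      exact Prod.ext (((hmem _ _).1 hx).1.trans ((hmem _ _).1 hy).1.symm) hxy
    have hmem' : ∀ x, x ∈ (L ++ H).map Prod.snd ↔ x ∈ T.away r r := by
      intro x
      rw [mem_away_self, List.mem_map]
      constructor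
      · rintro ⟨⟨v, y⟩, hy, rfl⟩
        exact ((hmem _ _).1 hy).2
      · intro hx
        exact ⟨(r, x), (hmem _ _).2 ⟨rfl, hx⟩, rfl⟩
    have hdeg : degreeList T {r} = [(T.away r r).card] := by
      simp [degreeList]
    refine ⟨node (tL ++ tH), r, ?_, isBranch_node.2 ⟨_, hnd', hmem',
      List.forall₂_map_left_iff.2 (List.forall₂_iff_get.2 ⟨hbranch.length_eq, fun i hi hi' => ?_⟩)⟩⟩
    · rw [hdeg]
      refine .done _ _ _ ?_
      rw [← length_eq_card_away hnd' hmem', ← htL.length_eq, ← htH.length_eq]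
      simp
    · have h1 := (List.forall₂_iff_get.1 hbranch).2 i hi hi'
      have h2 := ((hmem _ _).1 (List.getElem_mem hi)).1
      rw [← h2]
      exact h1
  have hE := hT.exchangeSystem hρ hext
  have htr : ∀ e ∈ L ++ H, ∀ e' ∈ L ++ H, branchValue ρ T e.1 e.2 = branchValue ρ T e'.1 e'.2 →
      ∀ t, IsBranch T e.1 e.2 t → IsBranch T e'.1 e'.2 t := by
    rintro ⟨v, x⟩ he ⟨w, y⟩ he' heq t ht
    have h1 := (h.mem_or v x).1 (by simpa using he)
    have h2 := (h.mem_or w y).1 (by simpa using he')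
    exact h.isBranch_of_value_eq hT hρ hext h1.1 h1.2.1 h1.2.2 h2.1 h2.2.1 h2.2.2 heq ht
  obtain ⟨p, hp, a, ha, hpa, hstep⟩ := h.exists_contraction hE
    (fun v w h => by exact_mod_cast h) (by omega)
  have hS' : (S.erase a).Nonempty := ⟨p, Finset.mem_erase.2 ⟨hpa.ne, hp⟩⟩
  have hn' : (S.erase a).card = n := by rw [Finset.card_erase_of_mem ha]; omega
  have hne : degreeList T (S.erase a) ≠ [] := by
    intro h0
    have : (T.away p p).card ∈ degreeList T (S.erase a) :=
      mem_degreeList.2 ⟨p, Finset.mem_erase.2 ⟨hpa.ne, hp⟩, rfl⟩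
    rw [h0] at this
    simp at this
  have hcard := hT.card_away_add_one hpa.ne'
  have hpaS : ∀ c, T.Adj a c → c ∉ S → c ∈ T.away a p := fun c hc hcS =>
    (mem_away_of_adj hT hpa.symm).2 ⟨hc, fun h => hcS (h ▸ hp)⟩
  rcases hstep with ⟨htop, hstate⟩ | ⟨hbot, hstate⟩
  · obtain ⟨H', tH', b, rfl, hb1, hb2, hb3, hb4, hb5, hb6⟩ := exists_split_at
      (r := fun e => branchValue ρ T e.1 e.2) hHn hH htH
      (fun e he e' he' => htr e (by simp [he]) e' (by simp [he'])) (p := p) (a := a)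
      (fun c => ⟨fun hc => by
          have h1 := (h.mem_or a c).1 (Or.inr (by simpa using hc))
          exact hpaS c h1.2.2 h1.2.1,
        fun hc => List.mem_toFinset.1 (htop.2 c hc).1⟩)
      (fun c hc e he hea => (htop.2 c hc).2 e.1 e.2 (Or.inr (by simpa using he)) hea)
    -- The new low tip was an inner edge, hence is at least as large as all old low tips and keeps
    -- the list sorted.
    have hpaL : ∀ e ∈ L, branchValue ρ T e.1 e.2 ≤ branchValue ρ T p a := fun e he =>
      h.lo_le e.1 e.2 (List.mem_toFinset.2 he) p hp a ha hpa
    obtain ⟨F, v, hF, hv⟩ := ih (S := S.erase a) hS' (L := (p, a) :: L) (H := H')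
      (tL := node b :: tL) (tH := tH') (by rw [List.toFinset_cons, hb4]; exact hstate)
      (List.nodup_cons.2 ⟨fun hmem => ((h.mem_or p a).1
        (Or.inl (List.mem_toFinset.2 hmem))).2.1 ha, hLn⟩) hb2
      (List.pairwise_cons.2 ⟨hpaL, hL⟩) hb3 (.cons hb6 htL) hb1 hn'
    refine ⟨F, v, ?_, hv⟩
    rw [degreeList_of_max ha fun s hs => Int.ofNat_le.1 (htop.1 s hs)]
    exact .low b (by omega) hne hF
  · have hle : ∀ s ∈ S, (T.away a a).card ≤ (T.away s s).card := fun s hs => by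
      have := hbot.1 s hs
      simp only [Pi.neg_apply, neg_le_neg_iff] at this
      exact_mod_cast this
    obtain ⟨L', tL', b, rfl, hb1, hb2, hb3, hb4, hb5, hb6⟩ := exists_split_at
      (r := fun e => -branchValue ρ T e.1 e.2) hLn (by simpa only [neg_le_neg_iff] using hL) htL
      (fun e he e' he' heq => htr e (by simp [he]) e' (by simp [he']) (neg_inj.1 heq))
      (p := p) (a := a)
      (fun c => ⟨fun hc => by
          have h1 := (h.mem_or a c).1 (Or.inl (by simpa using hc))
          exact hpaS c h1.2.2 h1.2.1,
        fun hc => List.mem_toFinset.1 (hbot.2 c hc).1⟩)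
      (fun c hc e he hea => (hbot.2 c hc).2 e.1 e.2 (Or.inr (by simpa using he)) hea)
    have hpaH : ∀ e ∈ H, branchValue ρ T p a ≤ branchValue ρ T e.1 e.2 := fun e he =>
      h.le_hi e.1 e.2 (List.mem_toFinset.2 he) p hp a ha hpa
    obtain ⟨F, v, hF, hv⟩ := ih (S := S.erase a) hS' (L := L') (H := (p, a) :: H)
      (tL := tL') (tH := node b :: tH) (by rw [List.toFinset_cons, hb4]; exact hstate) hb2
      (List.nodup_cons.2 ⟨fun hmem => ((h.mem_or p a).1
        (Or.inr (List.mem_toFinset.2 hmem))).2.1 ha, hHn⟩)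
      (by simpa only [neg_le_neg_iff] using hb3) (List.pairwise_cons.2 ⟨hpaH, hH⟩) hb1
      (.cons hb6 htH) hn'
    refine ⟨F, v, ?_, hv⟩
    rw [degreeList_of_min ha hle]
    exact .high b (by omega) hne hF

lemma IsBranch.leaf_iff {w v : V} {t : RTree} (h : IsBranch T w v t) :
    t = leaf ↔ T.away v w = ∅ := by
  obtain ⟨ts⟩ := t
  obtain ⟨l, hl, hmem, hts⟩ := isBranch_node.1 h
  have h1 := length_eq_card_away hl hmem
  rw [← Finset.card_eq_zero, ← h1, hts.length_eq, leaf, node.injEq, List.length_eq_zero_iff]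

lemma IsTree.exists_two_le_card (hT : T.IsTree) (hcard : 3 ≤ Fintype.card V) :
    ∃ v, 2 ≤ (T.away v v).card := by
  have two : ∀ v x y, T.Adj v x → T.Adj v y → x ≠ y → 2 ≤ (T.away v v).card := by
    intro v x y hx hy hxy
    exact Finset.one_lt_card.2 ⟨x, mem_away_self.2 hx, y, mem_away_self.2 hy, hxy⟩
  obtain ⟨x, y, z, hxy, hxz, hyz⟩ := Fintype.two_lt_card_iff.1 (show 2 < Fintype.card V by omega)
  have far : ∀ u w, u ≠ w → ¬ T.Adj u w → ∃ v, 2 ≤ (T.away v v).card := by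
    intro u w huw hn
    obtain ⟨v, hv, hd⟩ := hT.exists_adj_dist huw
    have hvw : v ≠ w := by rintro rfl; exact hn hv
    obtain ⟨v', hv', hd'⟩ := hT.exists_adj_dist hvw
    refine ⟨v, two v u v' hv.symm hv' ?_⟩
    rintro rfl
    omega
  by_cases h1 : T.Adj x y
  · by_cases h2 : T.Adj x z
    · exact ⟨x, two x y z h1 h2 hyz⟩
    · exact far x z hxz h2
  · exact far x y hxy h1

open Classical in
/-- An exchange-extremal tree is assembled from its leaves. -/
theorem IsTree.exists_assembles (hT : T.IsTree) (hρ : IsAlternatingInvariant ρ f)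
    (hext : ExchangeExtremal ρ T) (hcard : 3 ≤ Fintype.card V) :
    ∃ n F v, Assembles (degreeList T (Finset.univ.filter fun v => 2 ≤ (T.away v v).card)) []
      (List.replicate n leaf) F ∧ IsBranch T v v F := by
  set S : Finset V := Finset.univ.filter fun v => 2 ≤ (T.away v v).card with hS
  have memS : ∀ v, v ∈ S ↔ 2 ≤ (T.away v v).card := by simp [hS]
  set Hi : Finset (V × V) := Finset.univ.filter fun e => e.1 ∈ S ∧ e.2 ∉ S ∧ T.Adj e.1 e.2
  have hleaf : ∀ v x, T.Adj v x → x ∉ S → T.away x v = ∅ := by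
    intro v x hvx hx
    rw [memS] at hx
    have := hT.card_away_add_one hvx.ne'
    exact Finset.card_eq_zero.1 (by omega)
  have hvalue : ∀ v x, T.Adj v x → x ∉ S → branchValue ρ T v x = ρ leaf := by
    intro v x hvx hx
    obtain ⟨t, ht⟩ := hT.exists_isBranch v x
    rw [← ht.value_eq hρ, ht.leaf_iff.2 (hleaf v x hvx hx)]
  have hlt : ∀ p a, T.Adj p a → a ∈ S → branchValue ρ T p a < ρ leaf := by
    intro p a hpa ha
    obtain ⟨t, ht⟩ := hT.exists_isBranch p a
    rw [← ht.value_eq hρ]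
    refine hρ.lt_leaf t fun h0 => ?_
    rw [ht.leaf_iff, ← Finset.card_eq_zero] at h0
    rw [memS] at ha
    have := hT.card_away_add_one hpa.ne'
    omega
  have hmemHi : ∀ v x, (v, x) ∈ Hi ↔ v ∈ S ∧ x ∉ S ∧ T.Adj v x := by simp [Hi]
  -- Every inner branch has more than one vertex and is strictly below the common value of the high
  -- tips, so the conditions on ties are vacuous.
  have hstate : ContractionState T (branchValue ρ T) (fun v => ((T.away v v).card : ℤ)) S ∅ Hi := by
    refine ⟨?_, fun v hv => (memS v).1 hv, fun v x => by simp [hmemHi], by simp, by simp, ?_,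
      by simp, ?_⟩
    · intro v hv w hw a hva hd
      by_cases haw : a = w
      · rwa [haw]
      obtain ⟨c, hc, hcd⟩ := hT.exists_adj_dist haw
      -- A vertex strictly between two others has a neighbour on either side, so it is not a leaf.
      refine (memS a).2 (Finset.one_lt_card.2 ⟨v, mem_away_self.2 hva.symm, c,
        mem_away_self.2 hc, ?_⟩)
      rintro rfl
      omega
    · intro v x hvx p hp a ha hpa
      obtain ⟨-, h1, h2⟩ := (hmemHi v x).1 hvx
      rw [hvalue v x h2 h1]
      exact (hlt p a hpa ha).le
    · intro p hp a ha hpa v x hvx hle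
      obtain ⟨-, h1, h2⟩ := (hmemHi v x).1 hvx
      rw [hvalue v x h2 h1] at hle
      exact absurd (hlt p a hpa ha) (not_lt.2 hle)
  obtain ⟨v₀, hv₀⟩ := hT.exists_two_le_card hcard
  have hval : ∀ e ∈ Hi.toList, branchValue ρ T e.1 e.2 = ρ leaf := by
    rintro ⟨v, x⟩ he
    obtain ⟨-, h1, h2⟩ := (hmemHi v x).1 (Finset.mem_toList.1 he)
    exact hvalue v x h2 h1
  obtain ⟨F, v, hF, hv⟩ := ContractionState.assembles hT hρ hext ⟨v₀, (memS v₀).2 hv₀⟩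
    (L := []) (H := Hi.toList) (tL := []) (tH := List.replicate Hi.toList.length leaf)
    (by simpa using hstate) List.nodup_nil (Finset.nodup_toList _) List.Pairwise.nil
    (List.Pairwise.imp_of_mem (fun {e e'} he he' _ => by rw [hval e he, hval e' he'])
      (List.pairwise_of_forall (R := fun _ _ => True) (by simp))) .nil
    (List.forall₂_iff_get.2 ⟨by simp, fun i hi hi' => by
      obtain ⟨-, h1, h2⟩ := (hmemHi _ _).1 (Finset.mem_toList.1 (List.getElem_mem hi))
      obtain ⟨t, ht⟩ := hT.exists_isBranch (Hi.toList[i]).1 (Hi.toList[i]).2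
      have h3 := ht.leaf_iff.2 (hleaf _ _ h2 h1)
      subst h3
      simpa using ht⟩)
  exact ⟨_, F, v, hF, hv⟩

end SimpleGraph

theorem theorem3p3 (ρ : RTree → ℝ) (f : Multiset ℝ → ℝ)
    (hrec : HasRecurrenceRule ρ f)
    (hdec : StrictlyDecreasingRule f (Set.range ρ))
    (hmax : ∀ B : RTree, B ≠ RTree.leaf → ρ B < ρ RTree.leaf)
    {V : Type*} [Fintype V] (T : SimpleGraph V) [DecidableRel T.Adj]
    (hT : T.IsTree) (hcard : 3 ≤ Fintype.card V)
    (hext : ExchangeExtremal ρ T) :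
    Nonempty (T ≃g (mTree (reducedDegrees T)).graph) := by
  classical
  have hρ : IsAlternatingInvariant ρ f := ⟨hrec, hdec, hmax⟩
  have hdeg : ∀ v, T.degree v = (T.away v v).card := by
    intro v
    rw [← SimpleGraph.card_neighborFinset_eq_degree]
    congr 1
    ext x
    rw [SimpleGraph.mem_neighborFinset, SimpleGraph.mem_away_self]
  have hD : reducedDegrees T =
      T.degreeList (Finset.univ.filter fun v => 2 ≤ (T.away v v).card) := by
    rw [reducedDegrees, SimpleGraph.degreeList]
    congr 1
    simp only [hdeg, Multiset.filter_map, Finset.filter_val]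
    rfl
  obtain ⟨n, F, v, hF, hv⟩ := hT.exists_assembles hρ hext hcard
  rw [← hD] at hF
  have h2 : ∀ d ∈ reducedDegrees T, 2 ≤ d := by
    intro d hd
    rw [hD, SimpleGraph.mem_degreeList] at hd
    obtain ⟨w, hw, rfl⟩ := hd
    exact (Finset.mem_filter.1 hw).2
  have hne : reducedDegrees T ≠ [] := by
    obtain ⟨w, hw⟩ := hT.exists_two_le_card hcard
    intro h0
    have : (T.away w w).card ∈ reducedDegrees T := by
      rw [hD, SimpleGraph.mem_degreeList]
      exact ⟨w, by simpa using hw, rfl⟩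
    rw [h0] at this
    simp at this
  obtain ⟨m, hm⟩ := mTree_assembles hne h2
  -- Both assemblies have the same degrees and no low branches, so the count forces the same number
  -- of leaves.
  have hnm : m = n := by
    have h3 := hF.length_add
    have h4 := hm.length_add
    simp at h3 h4
    omega
  subst hnm
  obtain ⟨w, hw⟩ := (hF.sameUnrooted h2 hm V T hT).1 ⟨v, hv⟩
  exact hw.nonempty_iso hT
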